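/- An instance of a self-contained $k$-witness problem consists of a universe $U=\{0,\dots,n-1\}$ and a collection $\mathcal W$ of $k$-element subsets of $U$, the witnesses; let $N=|\mathcal W|$. A randomised decision oracle with error probability at most $c$ answers each call on a set $X\subseteq U$, independently of all other calls, with a bit which differs with probability at most $c$ from the correct answer to the question whether some $W\in\mathcal W$ satisfies $W\subseteq X$. The algorithm learns about $\mathcal W$ only through calls of two kinds: calls to the decision oracle, and checks which decide correctly whether a given set $X\subseteq U$ is a witness. Algorithms are programs of a random access machine with fair coin flips, uniform cost, and addition and truncated subtraction as arithmetic. **Theorem.** Let $c<\tfrac12$. There is a randomised algorithm, depending only on $c$, which takes as input $n$, $k$ and an accuracy $\epsilon>0$ (given as the integer $\lceil 1/\epsilon\rceil$), has access to calls of the two kinds above for an instance with parameters $n,k$, where the decision oracle has error probability at most $c$, and has the following properties. 1. It only ever outputs witnesses, and for every witness $W$ the probability that the algorithm halts with a list in which $W$ appears exactly once is at least $1-\epsilon$. 2. There is a constant $C$, depending only on $c$, such that the expected total number of calls (oracle calls and checks together) is at most $$C\,2^{Ck}\cdot \log^3(n+2)\cdot \max\{1,N\}\cdot\bigl(1+\log(1+1/\epsilon)\bigr)^{C}.$$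 3. For every $a\in\mathbb N$ there is a constant $C$, depending only on $c$ and $a$, such that for every function $g:\mathbb N\to\mathbb N$ with $g\ge 1$: if each call can be executed in time at most $g(k)\cdot n^{a}$, then the expected running time is at most $$C\,2^{Ck}\cdot g(k)\cdot (n+1)^{C}\cdot \max\{1,N\}\cdot\bigl(1+\log(1+1/\epsilon)\bigr)^{C}.$$ In particular, for fixed $\epsilon$ and $n\ge2$, $k\ge1$, $N\ge1$, the expected number of calls is at most $2^{O(k)}\log^3 n\cdot N$ and the expected running time is at most $2^{O(k)}\,g(k)\,n^{O(1)}\,N$; if $g$ is computable, the algorithm is an expected fully output fpt randomised enumeration scheme (expected-FOFPTRES): expected time at most $f(k)\,p(n,N,1/\epsilon)$ with $f$ computable and $p$ a polynomial. -/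

import Mathlib

namespace WitnessEnum

/-- An instance of a self-contained `k`-witness problem: a universe of `n` elements, numbered
`0, …, n - 1`, and a collection of `k`-element subsets of it, the witnesses. -/
structure Instance where
  n : ℕ
  k : ℕ
  witnesses : Finset (Finset (Fin n))
  card_eq : ∀ W ∈ witnesses, W.card = k

/-- The correct answer to the decision question on input `X`: is some witness contained in `X`? -/
def Instance.answer (I : Instance) (X : Finset (Fin I.n)) : Bool :=
  decide (∃ W ∈ I.witnesses, W ⊆ X)

/-- `ora X` is the law of the answer to one call on input `X`; the probability that the answer is
incorrect is at most `c`. Distinct calls are answered independently (see `step`). -/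
def IsRandomisedOracle (I : Instance) (c : ℝ) (ora : Finset (Fin I.n) → PMF Bool) : Prop :=
  ∀ X, ora X (!I.answer X) ≤ ENNReal.ofReal c

/-! ### The machine model

Randomised oracle RAM with uniform cost: finitely many registers are named by a program, the memory
is a sequence of cells addressed by natural numbers, and the arithmetic is addition and truncated
subtraction (no multiplication). Random bits are fair coin flips. Programs are structured. -/

/-- Expressions: literals, registers, memory cells at a computed address, sum, truncated
difference. -/
inductive Expr where
  | lit (c : ℕ)
  | reg (x : ℕ)
  | load (e : Expr)
  | add (e₁ e₂ : Expr)
  | sub (e₁ e₂ : Expr)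

/-- The number of operations in an expression. -/
def Expr.size : Expr → ℕ
  | .lit _ => 1
  | .reg _ => 1
  | .load e => e.size + 1
  | .add e₁ e₂ => e₁.size + e₂.size + 1
  | .sub e₁ e₂ => e₁.size + e₂.size + 1

/-- Programs. A subset `X` of the universe is passed to `query`, `check` and `emit` as the address
`e` of the first of `n` consecutive cells; cell number `i` is nonzero iff `i ∈ X`.
* `assign x e`: register `x` receives the value of `e`;
* `store a e`: the memory cell with address `a` receives the value of `e`;
* `flip x`: register `x` receives a fair random bit;
* `query x e`: register `x` receives the answer of the randomised decision oracle on `X`;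
* `check x e`: register `x` receives `1` if `X` is a witness and `0` otherwise;
* `emit e`: append `X` to the output list;
* `seq`, `branch` (if `e ≠ 0` then … else …), `loop` (while `e ≠ 0` do …). -/
inductive Cmd where
  | assign (x : ℕ) (e : Expr)
  | store (a e : Expr)
  | flip (x : ℕ)
  | query (x : ℕ) (e : Expr)
  | check (x : ℕ) (e : Expr)
  | emit (e : Expr)
  | seq (p q : Cmd)
  | branch (e : Expr) (p q : Cmd)
  | loop (e : Expr) (p : Cmd)

/-- Machine states for a universe of `n` elements: registers, memory, the list output so far, the
number of calls (`query` and `check`) made so far, and the time elapsed so far. -/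
structure State (n : ℕ) where
  reg : ℕ → ℕ
  mem : ℕ → ℕ
  out : List (Finset (Fin n))
  calls : ℕ
  time : ℕ

/-- The value of an expression. -/
def Expr.eval {n : ℕ} (s : State n) : Expr → ℕ
  | .lit c => c
  | .reg x => s.reg x
  | .load e => s.mem (e.eval s)
  | .add e₁ e₂ => e₁.eval s + e₂.eval s
  | .sub e₁ e₂ => e₁.eval s - e₂.eval s

namespace State

variable {n : ℕ}

/-- Let `d` units of time pass. -/
def tick (s : State n) (d : ℕ) : State n := { s with time := s.time + d }

/-- Record a call. -/
def call (s : State n) : State n := { s with calls := s.calls + 1 }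

/-- Write to a register. -/
def setReg (s : State n) (x v : ℕ) : State n := { s with reg := Function.update s.reg x v }

/-- Write to a memory cell. -/
def setMem (s : State n) (a v : ℕ) : State n := { s with mem := Function.update s.mem a v }

/-- Append a set to the output. -/
def push (s : State n) (X : Finset (Fin n)) : State n := { s with out := s.out ++ [X] }

/-- The subset of the universe stored in the `n` cells from address `a` on. -/
def setAt (s : State n) (a : ℕ) : Finset (Fin n) :=
  Finset.univ.filter fun i : Fin n => s.mem (a + i) ≠ 0

end State

/-- A configuration: the commands still to be executed, in order, and the current state. The
machine has halted when no command is left. -/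
abbrev Config (n : ℕ) := List Cmd × State n

/-- The law of the configuration after one step, on the instance `I` with the oracle `ora`, when the
execution of a call (of the oracle or of the witness check) takes time `τ`. Passing a set to a call
or to the output is charged `n` in addition. A halted configuration does not change any more. -/
noncomputable def step (I : Instance) (ora : Finset (Fin I.n) → PMF Bool) (τ : ℕ) :
    Config I.n → PMF (Config I.n)
  | ([], s) => PMF.pure ([], s)
  | (.assign x e :: K, s) => PMF.pure (K, (s.setReg x (e.eval s)).tick (e.size + 1))
  | (.store a e :: K, s) =>
      PMF.pure (K, (s.setMem (a.eval s) (e.eval s)).tick (a.size + e.size + 1))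
  | (.flip x :: K, s) =>
      (PMF.uniformOfFintype Bool).map fun b => (K, (s.setReg x b.toNat).tick 1)
  | (.query x e :: K, s) =>
      (ora (s.setAt (e.eval s))).map fun b =>
        (K, (s.setReg x b.toNat).call.tick (e.size + I.n + τ + 1))
  | (.check x e :: K, s) =>
      PMF.pure (K, (s.setReg x (decide (s.setAt (e.eval s) ∈ I.witnesses)).toNat).call.tick
        (e.size + I.n + τ + 1))
  | (.emit e :: K, s) => PMF.pure (K, (s.push (s.setAt (e.eval s))).tick (e.size + I.n + 1))
  | (.seq p q :: K, s) => PMF.pure (p :: q :: K, s.tick 1)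
  | (.branch e p q :: K, s) =>
      PMF.pure ((if e.eval s ≠ 0 then p else q) :: K, s.tick (e.size + 1))
  | (.loop e p :: K, s) =>
      PMF.pure (if e.eval s ≠ 0 then p :: .loop e p :: K else K, s.tick (e.size + 1))

/-- The initial state: the registers `0`, `1`, `2` hold `n`, `k` and `m`, all else is zero. The
accuracy `ε` is handed over as the integer `m = ⌈1 / ε⌉`. -/
def initState (n k m : ℕ) : State n where
  reg := fun x => if x = 0 then n else if x = 1 then k else if x = 2 then m else 0
  mem := fun _ => 0
  out := []
  calls := 0
  time := 0

/-- The law of the configuration after `t` steps of the program `P` on the instance `I` with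
accuracy `ε`. -/
noncomputable def run (P : Cmd) (I : Instance) (ora : Finset (Fin I.n) → PMF Bool) (τ : ℕ)
    (ε : ℝ) : ℕ → PMF (Config I.n)
  | 0 => PMF.pure ([P], initState I.n I.k ⌈1 / ε⌉₊)
  | t + 1 => (run P I ora τ ε t).bind (step I ora τ)

/-- The expected total number of calls. (The number of calls is nondecreasing along a run, so the
expectation of its limit is the supremum of the expectations.) -/
noncomputable def expectedCalls (P : Cmd) (I : Instance) (ora : Finset (Fin I.n) → PMF Bool)
    (τ : ℕ) (ε : ℝ) : ENNReal :=
  ⨆ t, ∑' x, run P I ora τ ε t x * (x.2.calls : ENNReal)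

/-- The expected total running time. (Every step before halting takes time at least `1`; so if this
is finite, then the program halts with probability one.) -/
noncomputable def expectedTime (P : Cmd) (I : Instance) (ora : Finset (Fin I.n) → PMF Bool)
    (τ : ℕ) (ε : ℝ) : ENNReal :=
  ⨆ t, ∑' x, run P I ora τ ε t x * (x.2.time : ENNReal)

/-- Everything that the program ever outputs is a witness, whatever the coin flips and the answers
of the oracle. -/
def OutputsOnlyWitnesses (P : Cmd) (I : Instance) (ora : Finset (Fin I.n) → PMF Bool)
    (τ : ℕ) (ε : ℝ) : Prop :=
  ∀ t, ∀ x ∈ (run P I ora τ ε t).support, ∀ X ∈ x.2.out, X ∈ I.witnesses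

/-- The probability that the program halts with an output list that contains `W` exactly once. (The
events for `t` steps increase with `t`.) -/
noncomputable def probListedOnce (P : Cmd) (I : Instance) (ora : Finset (Fin I.n) → PMF Bool)
    (τ : ℕ) (ε : ℝ) (W : Finset (Fin I.n)) : ENNReal :=
  ⨆ t, (run P I ora τ ε t).toOuterMeasure {x | x.1 = [] ∧ x.2.out.count W = 1}

end WitnessEnum

/-! The algorithm is a branching search. From a set `X` it draws `2 ^ k` uniformly random subsets
and recurses into those for which a majority vote of oracle calls is positive; sets left at height
zero are checked. A witness inside `X` survives one thinning with probability `2 ^ (-k)`, so its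
surviving copies form a nearly critical branching process. This balance drives both estimates.

Work (`expect_work_explore`): by linearity of expectation, the expected number of pairs (node,
witness inside it) does not grow from level to level (`expect_card_below`). A node entered by a
correct vote contains a witness, so there are on average at most `N` such nodes per level. Wrong
positive votes have probability at most `δ` with `2 ^ k * δ ≤ 1/2`, so the nodes they create die
out. One search over `D` levels costs `O(2 ^ k * (1 + D * N))` units.

Success (`miss_explore_le`): a critical process lives through `d` generations with probability of
order `1 / d`. The surviving set must also have lost all elements outside `W`; given that `W`
survives, their number halves in expectation at every thinning, so `D = O(log n)` levels with `2 ^ D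
> 2 * n` suffice. The bound `(1 - δ) ^ d / (d + 1) * (1 - |X \ W| / 2 ^ d)` on the success
probability is inductive: its last factor is affine in `|X \ W|`, hence can be averaged exactly
(`miss_trial_le`), and `1 / (d + 1)` becomes `1 / (d + 2)` by `one_sub_div_pow_le`. One search finds
`W` with probability at least `1 / (4 * (D + 1))`; independent rounds amplify this to `1 - ε`. A
Chernoff bound (`exists_votes`) shows that votes of length `O(k + D)` are reliable enough, and a
table with a cell for every subset prevents repeated output.

The transfer to the machine uses harmonic functions of the step kernel. A statistic that does not
decrease along runs has a limiting expectation that is harmonic (`harmonic_limExpect`) and agrees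
with the statistic at halted configurations. `Reaches` bounds every harmonic function at the start,
above and below, by expectations under an abstract law. Such statements compose like programs
(`Reaches.bind`), without stopping times or couplings; `reaches_main` links the whole program to the
abstract process `enumeration`. The upper half then controls calls, time and wrong outputs, the
lower half the success probability. -/

namespace WitnessEnum

open scoped ENNReal

/-! ### Expectations -/

/-- The expectation of a nonnegative function. -/
noncomputable def expect {α : Type*} (p : PMF α) (f : α → ℝ≥0∞) : ℝ≥0∞ := ∑' x, p x * f x

section expect

variable {α β : Type*}

@[simp] theorem expect_pure (a : α) (f : α → ℝ≥0∞) : expect (PMF.pure a) f = f a := by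
  unfold expect
  rw [tsum_eq_single a]
  · simp
  · intro b hb
    simp [PMF.pure_apply, hb]

theorem expect_bind (p : PMF α) (q : α → PMF β) (f : β → ℝ≥0∞) :
    expect (p.bind q) f = expect p fun a => expect (q a) f := by
  simp only [expect, PMF.bind_apply, ← ENNReal.tsum_mul_right, ← ENNReal.tsum_mul_left]
  rw [ENNReal.tsum_comm]
  simp only [mul_assoc]

theorem expect_map (p : PMF α) (g : α → β) (f : β → ℝ≥0∞) :
    expect (p.map g) f = expect p fun a => f (g a) := by
  rw [← PMF.bind_pure_comp, expect_bind]
  simp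

theorem expect_mono_support {p : PMF α} {f g : α → ℝ≥0∞} (h : ∀ a ∈ p.support, f a ≤ g a) :
    expect p f ≤ expect p g := by
  refine ENNReal.tsum_le_tsum fun a => ?_
  by_cases ha : p a = 0
  · simp [ha]
  · exact mul_le_mul_right (h a ((PMF.mem_support_iff _ _).2 ha)) _

theorem expect_mono {p : PMF α} {f g : α → ℝ≥0∞} (h : ∀ a, f a ≤ g a) :
    expect p f ≤ expect p g :=
  expect_mono_support fun a _ => h a

@[simp] theorem expect_const (p : PMF α) (c : ℝ≥0∞) : expect p (fun _ => c) = c := by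
  simp [expect, ENNReal.tsum_mul_right, p.tsum_coe]

theorem expect_add (p : PMF α) (f g : α → ℝ≥0∞) :
    (expect p fun a => f a + g a) = expect p f + expect p g := by
  simp only [expect, mul_add, ENNReal.tsum_add]

theorem expect_const_mul (p : PMF α) (c : ℝ≥0∞) (f : α → ℝ≥0∞) :
    (expect p fun a => c * f a) = c * expect p f := by
  simp only [expect, ← ENNReal.tsum_mul_left]
  exact tsum_congr fun a => by ring

theorem expect_mul_const (p : PMF α) (c : ℝ≥0∞) (f : α → ℝ≥0∞) :
    (expect p fun a => f a * c) = expect p f * c := by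
  simp only [mul_comm _ c, expect_const_mul]

theorem expect_finset_sum {ι : Type*} (p : PMF α) (t : Finset ι) (f : ι → α → ℝ≥0∞) :
    (expect p fun a => ∑ i ∈ t, f i a) = ∑ i ∈ t, expect p (f i) := by
  classical
  induction t using Finset.induction_on with
  | empty => simp
  | insert i t hi ih => simp only [Finset.sum_insert hi, expect_add, ih]

theorem expect_bool (p : PMF Bool) (f : Bool → ℝ≥0∞) :
    expect p f = p true * f true + p false * f false := by
  simp [expect, tsum_fintype]

theorem expect_coin (f : Bool → ℝ≥0∞) :
    expect (PMF.uniformOfFintype Bool) f = 2⁻¹ * f true + 2⁻¹ * f false := by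
  simp [expect_bool]

/-- Monotone convergence: the sum is an integral against counting measure on the discrete measurable
space. -/
theorem expect_iSup_of_monotone (p : PMF α) (f : ℕ → α → ℝ≥0∞) (hf : ∀ a, Monotone fun t => f t a) :
    (expect p fun a => ⨆ t, f t a) = ⨆ t, expect p (f t) := by
  let _ : MeasurableSpace α := ⊤
  have key : ∀ g : α → ℝ≥0∞, expect p g = ∫⁻ a, p a * g a ∂MeasureTheory.Measure.count := by
    intro g
    rw [MeasureTheory.lintegral_count]
    rfl
  simp only [key, ENNReal.mul_iSup]
  refine MeasureTheory.lintegral_iSup (fun t => measurable_from_top) ?_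
  intro t u htu a
  exact mul_le_mul_right (hf a htu) _

end expect

/-! ### Limits along runs, and abstract descriptions of runs -/

section framework

variable {I : Instance} {ora : Finset (Fin I.n) → PMF Bool} {τ : ℕ} {α β : Type*}

/-- A function on configurations that is preserved in expectation by every step. -/
def Harmonic (I : Instance) (ora : Finset (Fin I.n) → PMF Bool) (τ : ℕ)
    (F : Config I.n → ℝ≥0∞) : Prop :=
  ∀ x, F x = expect (step I ora τ x) F

/-- The expectation of `f` after `t` steps from a given configuration. -/
noncomputable def afterSteps (I : Instance) (ora : Finset (Fin I.n) → PMF Bool) (τ : ℕ)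
    (f : Config I.n → ℝ≥0∞) : ℕ → Config I.n → ℝ≥0∞
  | 0 => f
  | t + 1 => fun x => expect (step I ora τ x) (afterSteps I ora τ f t)

theorem expect_run (P : Cmd) (ε : ℝ) (t : ℕ) (f : Config I.n → ℝ≥0∞) :
    expect (run P I ora τ ε t) f =
      afterSteps I ora τ f t ([P], initState I.n I.k ⌈1 / ε⌉₊) := by
  induction t generalizing f with
  | zero => simp [run, afterSteps]
  | succ t ih =>
    rw [run, expect_bind, ih]
    clear ih
    generalize (([P], initState I.n I.k ⌈1 / ε⌉₊) : Config I.n) = x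
    induction t generalizing x with
    | zero => rfl
    | succ t ih =>
      exact congrArg (expect (step I ora τ x)) (funext ih)

/-- The limit of the expectation of `f` along runs. -/
noncomputable def limExpect (I : Instance) (ora : Finset (Fin I.n) → PMF Bool) (τ : ℕ)
    (f : Config I.n → ℝ≥0∞) (x : Config I.n) : ℝ≥0∞ :=
  ⨆ t, afterSteps I ora τ f t x

theorem afterSteps_monotone {f : Config I.n → ℝ≥0∞} (hf : ∀ x, f x ≤ expect (step I ora τ x) f)
    (x : Config I.n) : Monotone fun t => afterSteps I ora τ f t x := by
  refine monotone_nat_of_le_succ fun t => ?_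
  induction t generalizing x with
  | zero => exact hf x
  | succ t ih => exact expect_mono ih

/-- One more step only shifts the index of an increasing sequence, and monotone convergence moves
the supremum through the step. This is the source of all harmonic functions used later. -/
theorem harmonic_limExpect {f : Config I.n → ℝ≥0∞}
    (hf : ∀ x, f x ≤ expect (step I ora τ x) f) : Harmonic I ora τ (limExpect I ora τ f) := by
  intro x
  unfold limExpect
  rw [expect_iSup_of_monotone _ _ (afterSteps_monotone hf)]
  exact ((afterSteps_monotone hf x).iSup_nat_add 1).symm

theorem limExpect_halted (f : Config I.n → ℝ≥0∞) (s : State I.n) :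
    limExpect I ora τ f ([], s) = f ([], s) := by
  have h : ∀ t, afterSteps I ora τ f t ([], s) = f ([], s) := by
    intro t
    induction t with
    | zero => rfl
    | succ t ih => simp [afterSteps, step, ih]
  simp [limExpect, h]

/-- The run from `x` passes surely through `y`. -/
def Leads (I : Instance) (ora : Finset (Fin I.n) → PMF Bool) (τ : ℕ) (x y : Config I.n) : Prop :=
  ∀ F, Harmonic I ora τ F → F x = F y

/-- The run from `x` passes surely through a configuration that stands in the relation `R` to a
random element with law `A`. -/
def Reaches (ora : Finset (Fin I.n) → PMF Bool) (τ : ℕ) (x : Config I.n) (A : PMF α)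
    (R : α → Config I.n → Prop) : Prop :=
  ∀ F, Harmonic I ora τ F → ∀ G : α → ℝ≥0∞,
    ((∀ a y, R a y → F y ≤ G a) → F x ≤ expect A G) ∧
    ((∀ a y, R a y → G a ≤ F y) → expect A G ≤ F x)

theorem Leads.refl (x : Config I.n) : Leads I ora τ x x := fun _ _ => rfl

theorem Leads.trans {x y z : Config I.n} (h₁ : Leads I ora τ x y) (h₂ : Leads I ora τ y z) :
    Leads I ora τ x z := fun F hF => (h₁ F hF).trans (h₂ F hF)

theorem leads_of_step {x y : Config I.n} (h : step I ora τ x = PMF.pure y) :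
    Leads I ora τ x y := by
  intro F hF
  rw [hF x, h, expect_pure]

theorem Reaches.of_leads {x y : Config I.n} {A : PMF α} {R : α → Config I.n → Prop}
    (h : Leads I ora τ x y) (h' : Reaches ora τ y A R) : Reaches ora τ x A R := by
  intro F hF G
  rw [h F hF]
  exact h' F hF G

theorem Reaches.pure {x : Config I.n} {a : α} {R : α → Config I.n → Prop} (h : R a x) :
    Reaches ora τ x (PMF.pure a) R := by
  intro F hF G
  rw [expect_pure]
  exact ⟨fun H => H a x h, fun H => H a x h⟩

/-- The second statement, applied to `G`, supplies the bounds that the first one needs for the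
function `a ↦ expect (B a) G`. -/
theorem Reaches.bind {x : Config I.n} {A : PMF α} {R : α → Config I.n → Prop}
    {B : α → PMF β} {R' : β → Config I.n → Prop} (h : Reaches ora τ x A R)
    (h' : ∀ a y, R a y → Reaches ora τ y (B a) R') : Reaches ora τ x (A.bind B) R' := by
  intro F hF G
  rw [expect_bind]
  exact ⟨fun H => (h F hF _).1 fun a y hy => (h' a y hy F hF G).1 H,
    fun H => (h F hF _).2 fun a y hy => (h' a y hy F hF G).2 H⟩

theorem Reaches.map {x : Config I.n} {A : PMF α} {R : α → Config I.n → Prop}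
    {g : α → β} {R' : β → Config I.n → Prop} (h : Reaches ora τ x A R)
    (h' : ∀ a y, R a y → R' (g a) y) : Reaches ora τ x (A.map g) R' := by
  rw [← PMF.bind_pure_comp]
  exact h.bind fun a y hy => Reaches.pure (h' a y hy)

theorem Reaches.mono {x : Config I.n} {A : PMF α} {R R' : α → Config I.n → Prop}
    (h : Reaches ora τ x A R) (h' : ∀ a y, R a y → R' a y) : Reaches ora τ x A R' :=
  fun F hF G => ⟨fun H => (h F hF G).1 fun a y hy => H a y (h' a y hy),
    fun H => (h F hF G).2 fun a y hy => H a y (h' a y hy)⟩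

theorem reaches_of_step {x : Config I.n} {A : PMF α} {g : α → Config I.n}
    (h : step I ora τ x = A.map g) : Reaches ora τ x A fun a y => y = g a := by
  intro F hF G
  rw [hF x, h, expect_map]
  exact ⟨fun H => expect_mono fun a => H a _ rfl, fun H => expect_mono fun a => H a _ rfl⟩

/-! ### Single steps -/

variable {K : List Cmd} {s : State I.n}

theorem leads_assign {x : ℕ} {e : Expr} : Leads I ora τ (.assign x e :: K, s)
    (K, (s.setReg x (e.eval s)).tick (e.size + 1)) := leads_of_step rfl

theorem leads_store {a e : Expr} : Leads I ora τ (.store a e :: K, s)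
    (K, (s.setMem (a.eval s) (e.eval s)).tick (a.size + e.size + 1)) := leads_of_step rfl

theorem leads_check {x : ℕ} {e : Expr} : Leads I ora τ (.check x e :: K, s)
    (K, (s.setReg x (decide (s.setAt (e.eval s) ∈ I.witnesses)).toNat).call.tick
        (e.size + I.n + τ + 1)) := leads_of_step rfl

theorem leads_emit {e : Expr} : Leads I ora τ (.emit e :: K, s)
    (K, (s.push (s.setAt (e.eval s))).tick (e.size + I.n + 1)) := leads_of_step rfl

theorem leads_seq {p q : Cmd} : Leads I ora τ (.seq p q :: K, s) (p :: q :: K, s.tick 1) :=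
  leads_of_step rfl

theorem leads_branch_true {e : Expr} {p q : Cmd} (h : e.eval s ≠ 0) :
    Leads I ora τ (.branch e p q :: K, s) (p :: K, s.tick (e.size + 1)) :=
  leads_of_step (by simp [step, h])

theorem leads_branch_false {e : Expr} {p q : Cmd} (h : e.eval s = 0) :
    Leads I ora τ (.branch e p q :: K, s) (q :: K, s.tick (e.size + 1)) :=
  leads_of_step (by simp [step, h])

theorem leads_loop_true {e : Expr} {p : Cmd} (h : e.eval s ≠ 0) :
    Leads I ora τ (.loop e p :: K, s) (p :: .loop e p :: K, s.tick (e.size + 1)) :=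
  leads_of_step (by simp [step, h])

theorem leads_loop_false {e : Expr} {p : Cmd} (h : e.eval s = 0) :
    Leads I ora τ (.loop e p :: K, s) (K, s.tick (e.size + 1)) :=
  leads_of_step (by simp [step, h])

theorem reaches_flip {x : ℕ} : Reaches ora τ (.flip x :: K, s) (PMF.uniformOfFintype Bool)
    fun b y => y = (K, (s.setReg x b.toNat).tick 1) := reaches_of_step rfl

theorem reaches_query {x : ℕ} {e : Expr} :
    Reaches ora τ (.query x e :: K, s) (ora (s.setAt (e.eval s)))
    fun b y => y = (K, (s.setReg x b.toNat).call.tick (e.size + I.n + τ + 1)) :=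
  reaches_of_step rfl

/-! ### Quantities that do not decrease along runs -/

/-- Each conjunct makes one statistic nondecreasing along runs: calls, time, the event of a wrong
output, and the event of having halted with a given output. -/
theorem step_support {x y : Config I.n} (h : y ∈ (step I ora τ x).support) :
    x.2.calls ≤ y.2.calls ∧ x.2.time ≤ y.2.time ∧ x.2.out ⊆ y.2.out ∧ (x.1 = [] → y = x) := by
  obtain ⟨K, s⟩ := x
  rcases K with _ | ⟨p, K⟩
  · simp [step] at h
    simp [h]
  · cases p <;> simp [step] at h <;>
      first
        | (subst h; simp [State.tick, State.call, State.setReg, State.setMem, State.push])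
        | (rcases h with h | h <;> subst h <;> simp [State.tick, State.setReg])
        | (rcases h with ⟨-, h⟩ | ⟨-, h⟩ <;> subst h <;>
            simp [State.tick, State.call, State.setReg])

theorem le_expect_step {f : Config I.n → ℝ≥0∞} {x : Config I.n}
    (h : ∀ y ∈ (step I ora τ x).support, f x ≤ f y) : f x ≤ expect (step I ora τ x) f := by
  calc f x = expect (step I ora τ x) (fun _ => f x) := (expect_const _ _).symm
    _ ≤ _ := expect_mono_support h

end framework

/-! ### The abstract process -/

/-- A uniformly random subset of `{0, …, i - 1}`. -/
noncomputable def randomSubset : ℕ → PMF (Finset ℕ)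
  | 0 => PMF.pure ∅
  | i + 1 => (randomSubset i).bind fun F =>
      (PMF.uniformOfFintype Bool).map fun b => if b then insert i F else F

/-- The elements of `X` whose number belongs to `F`. -/
def thin {n : ℕ} (X : Finset (Fin n)) (F : Finset ℕ) : Finset (Fin n) :=
  X.filter fun u => (u : ℕ) ∈ F

/-- The number of positive answers among `i` independent answers with law `q`. -/
noncomputable def yesCount (q : PMF Bool) : ℕ → PMF ℕ
  | 0 => PMF.pure 0
  | i + 1 => (yesCount q i).bind fun v => q.map fun b => v + b.toNat

/-- The majority vote of `ρ` independent answers with law `q`. -/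
noncomputable def majority (q : PMF Bool) (ρ : ℕ) : PMF Bool :=
  (yesCount q ρ).map fun v => decide (ρ < v + v)

/-- The outcome of a search: the sets found, and a measure of the work done. -/
abbrev Outcome (n : ℕ) := Finset (Finset (Fin n)) × ℕ

/-- Combination of the outcomes of two successive searches. -/
def Outcome.join {n : ℕ} (r r' : Outcome n) : Outcome n := (r.1 ∪ r'.1, r.2 + r'.2)

/-- Count one more unit of work. -/
def Outcome.succ {n : ℕ} (r : Outcome n) : Outcome n := (r.1, r.2 + 1)

/-- `j` independent repetitions of a search. -/
noncomputable def repeated {n : ℕ} (A : PMF (Outcome n)) : ℕ → PMF (Outcome n)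
  | 0 => PMF.pure (∅, 0)
  | j + 1 => A.bind fun r => (repeated A j).map r.join

/-- Pass to a random subset of `X`, and go on with `next` if the majority vote is positive. -/
noncomputable def trial {n : ℕ} (ora : Finset (Fin n) → PMF Bool) (ρ : ℕ)
    (next : Finset (Fin n) → PMF (Outcome n)) (X : Finset (Fin n)) : PMF (Outcome n) :=
  (randomSubset n).bind fun F => (majority (ora (thin X F)) ρ).bind fun b =>
    if b then (next (thin X F)).map Outcome.succ else PMF.pure (∅, 1)

/-- The branching search below `X`: on each of `d` levels, `R` random subsets are tried. -/
noncomputable def explore {n : ℕ} (ora : Finset (Fin n) → PMF Bool) (R ρ : ℕ) :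
    ℕ → Finset (Fin n) → PMF (Outcome n)
  | 0, X => PMF.pure ({X}, 1)
  | d + 1, X => (repeated (trial ora ρ (explore ora R ρ d) X) R).map Outcome.succ

/-! ### The program

Registers: `0`, `1`, `2` hold the input `n`, `k`, `m`; `3` holds the branching number `2 ^ k`; `4`
holds `2 ^ n`, the address of the first frame; `5` holds the number of levels; `6` the number of
answers in a majority vote; `7` the number of rounds left; `8` the address of the current frame; `9`
the height of the current frame; `10`–`13` are scratch registers.

Each frame consists of `n` cells for a set and a cell for the number of trials left. The cells below
`2 ^ n` mark the sets already visited. -/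

namespace Prog

open _root_.WitnessEnum.Expr _root_.WitnessEnum.Cmd

/-- The address of the frame above the current one. -/
def childAddr : Expr := add (add (reg 8) (reg 0)) (lit 1)

/-- The address of the trial counter of the current frame. -/
def counterAddr : Expr := add (reg 8) (reg 0)

def skip : Cmd := assign 11 (lit 0)

/-- Truncated subtraction acts as conjunction: `1 - cell` is zero exactly when the element is
present, and subtracting it from the coin leaves the coin; otherwise it leaves zero. -/
def thinBody : Cmd :=
  seq (flip 11) (seq
    (store (add childAddr (reg 10)) (sub (reg 11) (sub (lit 1) (load (add (reg 8) (reg 10))))))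
    (assign 10 (add (reg 10) (lit 1))))

def thinLoop : Cmd := loop (sub (reg 0) (reg 10)) thinBody

/-- Write a random subset of the current set to the next frame. -/
def thinCmd : Cmd := seq (assign 10 (lit 0)) thinLoop

def voteBody : Cmd :=
  seq (query 11 childAddr) (seq (assign 12 (add (reg 12) (reg 11)))
    (assign 13 (sub (reg 13) (lit 1))))

def voteLoop : Cmd := loop (reg 13) voteBody

/-- Count the positive answers to repeated queries on the next frame. -/
def voteCmd : Cmd := seq (assign 12 (lit 0)) (seq (assign 13 (reg 6)) voteLoop)

def codeBody : Cmd :=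
  seq (branch (load (add (reg 8) (reg 10))) (assign 12 (add (reg 12) (reg 13))) skip)
    (seq (assign 13 (add (reg 13) (reg 13))) (assign 10 (add (reg 10) (lit 1))))

def codeLoop : Cmd := loop (sub (reg 0) (reg 10)) codeBody

/-- Compute the number whose binary expansion is the current set. -/
def codeCmd : Cmd :=
  seq (assign 10 (lit 0)) (seq (assign 12 (lit 0)) (seq (assign 13 (lit 1)) codeLoop))

/-- Output the current set if it is a witness that has not been visited before. -/
def visitCmd : Cmd :=
  seq codeCmd (branch (load (reg 12)) skip (seq (store (reg 12) (lit 1))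
    (seq (check 11 (reg 8)) (branch (reg 11) (emit (reg 8)) skip))))

/-- The height counts the levels still below a frame, so it rises when a frame is left. Leaving the
root makes it exceed the number of levels, which ends `search`. -/
def pop : Cmd :=
  seq (assign 8 (sub (reg 8) (add (reg 0) (lit 1)))) (assign 9 (add (reg 9) (lit 1)))

def push : Cmd :=
  seq (assign 8 childAddr) (seq (assign 9 (sub (reg 9) (lit 1))) (store counterAddr (reg 3)))

def expand : Cmd :=
  seq (store counterAddr (sub (load counterAddr) (lit 1)))
    (seq thinCmd (seq voteCmd (branch (sub (add (reg 12) (reg 12)) (reg 6)) push skip)))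

/-- At height zero the set is visited; otherwise the trial counter decides between another trial and
leaving the frame. -/
def searchBody : Cmd :=
  branch (reg 9) (branch (load counterAddr) expand pop) (seq visitCmd pop)

/-- Depth-first search through the tree of random subsets. -/
def search : Cmd := loop (sub (add (reg 5) (lit 1)) (reg 9)) searchBody

def fillLoop : Cmd :=
  loop (sub (reg 0) (reg 10)) (seq (store (add (reg 4) (reg 10)) (lit 1))
    (assign 10 (add (reg 10) (lit 1))))

/-- Write the whole universe to the first frame. -/
def fill : Cmd := seq (assign 10 (lit 0)) fillLoop

/-- The stack is rebuilt from the universe, while the table of visited sets persists between rounds.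
-/
def round : Cmd :=
  seq (assign 7 (sub (reg 7) (lit 1))) (seq fill (seq (assign 8 (reg 4)) (seq (assign 9 (reg 5))
    (seq (store counterAddr (reg 3)) search))))

def rounds : Cmd := loop (reg 7) round

def powLoop (y : ℕ) : Cmd :=
  loop (reg 10) (seq (assign y (add (reg y) (reg y))) (assign 10 (sub (reg 10) (lit 1))))

/-- Register `y` receives two to the power of register `x`. -/
def pow (x y : ℕ) : Cmd := seq (assign 10 (reg x)) (seq (assign y (lit 1)) (powLoop y))

def sizeLoop (x y : ℕ) (e : Expr) : Cmd :=
  loop (sub (add (reg x) (lit 1)) (reg 13))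
    (seq (assign 13 (add (reg 13) (reg 13))) (assign y (add (reg y) e)))

/-- Register `y` is increased by `e` for each binary digit of register `x`. -/
def size (x y : ℕ) (e : Expr) : Cmd := seq (assign 13 (lit 1)) (sizeLoop x y e)

def votesLoop (A : ℕ) : Cmd :=
  loop (reg 10) (seq (assign 6 (add (reg 6) (lit A))) (assign 10 (sub (reg 10) (lit 1))))

/-- Compute the number of answers in a majority vote. -/
def votes (A : ℕ) : Cmd := seq (assign 10 (add (reg 1) (add (reg 5) (lit 1)))) (votesLoop A)

/-- Four times (number of levels plus one). -/
def roundsPerDigit : Expr :=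
  add (add (add (reg 5) (lit 1)) (add (reg 5) (lit 1)))
    (add (add (reg 5) (lit 1)) (add (reg 5) (lit 1)))

/-- The enumeration algorithm. -/
def main (A : ℕ) : Cmd :=
  seq (pow 1 3) (seq (pow 0 4) (seq (assign 5 (lit 1)) (seq (size 0 5 (lit 1))
    (seq (votes A) (seq (size 2 7 roundsPerDigit) rounds)))))

end Prog

/-! ### The table of visited sets -/

/-- The number whose binary expansion is `Y`. -/
def code {n : ℕ} (Y : Finset (Fin n)) : ℕ := ∑ j ∈ Y, 2 ^ (j : ℕ)

theorem code_eq_map {n : ℕ} (Y : Finset (Fin n)) :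
    code Y = ∑ j ∈ Y.map Fin.valEmbedding, 2 ^ j := by
  simp [code]

/-- This keeps the table disjoint from the frames, which start at address `2 ^ n`. -/
theorem code_lt {n : ℕ} (Y : Finset (Fin n)) : code Y < 2 ^ n := by
  rw [code_eq_map]
  refine Nat.geomSum_lt le_rfl ?_
  simp only [Finset.mem_map]
  rintro _ ⟨j, -, rfl⟩
  exact j.2

/-- Binary expansions are unique, so marking one set never marks another. -/
theorem code_injective {n : ℕ} : Function.Injective (code : Finset (Fin n) → ℕ) := by
  intro Y Z h
  rw [code_eq_map, code_eq_map] at h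
  exact Finset.map_injective _ (Finset.geomSum_injective le_rfl h)

/-- The sets visited so far are marked in the table, and the output lists the witnesses among them
exactly once. -/
structure Table {I : Instance} (s : State I.n) (V : Finset (Finset (Fin I.n))) : Prop where
  mark : ∀ Y, s.mem (code Y) ≠ 0 ↔ Y ∈ V
  witness : ∀ X ∈ s.out, X ∈ I.witnesses
  count : ∀ W ∈ I.witnesses, s.out.count W = if W ∈ V then 1 else 0

theorem Table.congr {I : Instance} {s s' : State I.n} {V : Finset (Finset (Fin I.n))}
    (h : Table s V) (hm : ∀ x < 2 ^ I.n, s'.mem x = s.mem x) (ho : s'.out = s.out) :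
    Table s' V where
  mark Y := by rw [hm _ (code_lt Y), h.mark]
  witness := by rw [ho]; exact h.witness
  count := by rw [ho]; exact h.count

/-! ### Correctness of the parts of the program -/

section verify

open Prog

variable {I : Instance} {ora : Finset (Fin I.n) → PMF Bool} {τ : ℕ}

/-- The loop invariant after `i` passes, matching the recursion of `randomSubset`. The child frame
lies above the parent frame, so the set being read is never overwritten. -/
theorem reaches_thinLoop (K : List Cmd) (s : State I.n) (h0 : s.reg 0 = I.n) (h10 : s.reg 10 = 0)
    {i : ℕ} (hi : i ≤ I.n) :
    Reaches ora τ (thinLoop :: K, s) (randomSubset i) fun F y => ∃ s', y = (thinLoop :: K, s') ∧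
      (∀ x, x ≠ 10 → x ≠ 11 → s'.reg x = s.reg x) ∧ s'.reg 10 = i ∧ (∀ j ∈ F, j < i) ∧
      (∀ j < i, s'.mem (s.reg 8 + I.n + 1 + j) ≠ 0 ↔ s.mem (s.reg 8 + j) ≠ 0 ∧ j ∈ F) ∧
      (∀ x < s.reg 8 + I.n + 1, s'.mem x = s.mem x) ∧
      s'.out = s.out ∧ s'.calls = s.calls ∧ s'.time = s.time + 27 * i := by
  induction i with
  | zero => exact Reaches.pure ⟨s, rfl, by simp [h10]⟩
  | succ i ih =>
    refine (ih (by omega)).bind ?_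
    rintro F y ⟨s₁, rfl, hr, hr10, hF, hm, hlow, ho, hc, ht⟩
    have e0 : s₁.reg 0 = I.n := by rw [hr 0 (by simp) (by simp), h0]
    have e8 : s₁.reg 8 = s.reg 8 := hr 8 (by simp) (by simp)
    refine Reaches.of_leads ((leads_loop_true (by simp [Expr.eval, e0, hr10]; omega)).trans
      leads_seq) ?_
    rw [← PMF.bind_pure_comp]
    refine reaches_flip.bind ?_
    rintro b y rfl
    refine Reaches.of_leads (leads_seq.trans (leads_store.trans leads_assign))
      (Reaches.pure ⟨_, rfl, ?_⟩)
    simp only [State.tick, State.setReg, State.setMem, Expr.eval, Expr.size, Function.update_apply,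
      childAddr, e0, e8, hr10, ho, hc, ht]
    -- Element `i` has not been drawn yet, so its membership is decided by the present coin alone.
    have hiF : i ∉ F := fun h => (hF i h).false
    refine ⟨fun x h h' => by simp [h, h', hr], by simp, ?_, ?_, ?_, trivial, trivial, by omega⟩
    · intro j hj
      cases b <;> simp at hj
      · exact (hF j hj).trans (by omega)
      · rcases hj with rfl | hj
        · omega
        · exact (hF j hj).trans (by omega)
    · intro j hj
      rcases Nat.lt_succ_iff_lt_or_eq.1 hj with hj | rfl
      · have := hm j hj
        cases b <;> simp [hj.ne, this]
      · have := hlow (s.reg 8 + j) (by omega)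
        cases b <;> simp [hiF, this]
        omega
    · intro x hx
      have h1 : x ≠ s.reg 8 + I.n + 1 + i := by omega
      simp [h1, hlow x hx]

theorem setAt_eq_thin {s s' : State I.n} {a b : ℕ} {F : Finset ℕ}
    (h : ∀ j < I.n, s'.mem (b + j) ≠ 0 ↔ s.mem (a + j) ≠ 0 ∧ j ∈ F) :
    s'.setAt b = thin (s.setAt a) F := by
  ext u
  simp only [State.setAt, thin, Finset.mem_filter, Finset.mem_univ, true_and]
  exact h u u.2

theorem reaches_thin (K : List Cmd) (s : State I.n) (h0 : s.reg 0 = I.n) :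
    Reaches ora τ (thinCmd :: K, s) (randomSubset I.n) fun F y => ∃ s', y = (K, s') ∧
      (∀ x < 10, s'.reg x = s.reg x) ∧
      s'.setAt (s.reg 8 + I.n + 1) = thin (s.setAt (s.reg 8)) F ∧
      (∀ x < s.reg 8 + I.n + 1, s'.mem x = s.mem x) ∧
      s'.out = s.out ∧ s'.calls = s.calls ∧ s'.time ≤ s.time + 27 * (I.n + 1) := by
  -- As a bind with `pure`, the law leaves room for the failing loop test that follows the last
  -- pass.
  rw [← PMF.map_id (randomSubset I.n), ← PMF.bind_pure_comp]
  refine Reaches.of_leads (leads_seq.trans leads_assign) ((reaches_thinLoop K _ ?_ ?_ le_rfl).bind ?_)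
  · simpa [State.tick, State.setReg]
  · simp [State.tick, State.setReg, Expr.eval]
  · rintro F y ⟨s₁, rfl, hr, hr10, -, hm, hlow, ho, hc, ht⟩
    have e0 : s₁.reg 0 = I.n := by
      rw [hr 0 (by simp) (by simp)]
      simpa [State.tick, State.setReg]
    refine Reaches.of_leads (leads_loop_false (by simp [Expr.eval, e0, hr10]))
      (Reaches.pure ⟨_, rfl, ?_⟩)
    simp [State.tick, State.setReg] at hm hlow ho hc ht hr
    refine ⟨fun x hx => ?_, setAt_eq_thin fun j hj => ?_, fun x hx => hlow x (by omega), ho, hc, ?_⟩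
    · have h1 : x ≠ 10 := by omega
      simp [State.tick, hr x h1 (by omega), h1]
    · simpa [State.tick] using hm j hj
    · simp [State.tick, ht, Expr.size]
      omega

theorem reaches_voteLoop (K : List Cmd) (s : State I.n) (h0 : s.reg 0 = I.n)
    {i : ℕ} (hi : i ≤ s.reg 13) :
    Reaches ora τ (voteLoop :: K, s) (yesCount (ora (s.setAt (s.reg 8 + I.n + 1))) i)
      fun v y => ∃ s', y = (voteLoop :: K, s') ∧
      (∀ x, x ≠ 11 → x ≠ 12 → x ≠ 13 → s'.reg x = s.reg x) ∧ s'.reg 12 = s.reg 12 + v ∧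
      s'.reg 13 = s.reg 13 - i ∧ s'.mem = s.mem ∧
      s'.out = s.out ∧ s'.calls = s.calls + i ∧ s'.time = s.time + i * (I.n + τ + 18) := by
  induction i with
  | zero => exact Reaches.pure ⟨s, rfl, by simp⟩
  | succ i ih =>
    refine (ih (by omega)).bind ?_
    rintro v y ⟨s₁, rfl, hr, hr12, hr13, hm, ho, hc, ht⟩
    have e0 : s₁.reg 0 = I.n := by rw [hr 0 (by simp) (by simp) (by simp), h0]
    have e8 : s₁.reg 8 = s.reg 8 := hr 8 (by simp) (by simp) (by simp)
    refine Reaches.of_leads ((leads_loop_true (by simp [Expr.eval, hr13]; omega)).trans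
      leads_seq) ?_
    rw [← PMF.bind_pure_comp]
    have hX : s.setAt (s.reg 8 + I.n + 1) =
        ((s₁.tick ((Expr.reg 13).size + 1)).tick 1).setAt
          (childAddr.eval ((s₁.tick ((Expr.reg 13).size + 1)).tick 1)) := by
      simp [State.setAt, State.tick, childAddr, Expr.eval, hm, e0, e8]
    rw [hX]
    refine reaches_query.bind ?_
    rintro b y rfl
    refine Reaches.of_leads (leads_seq.trans (leads_assign.trans leads_assign))
      (Reaches.pure ⟨_, rfl, ?_⟩)
    simp only [State.tick, State.setReg, State.call, Expr.eval, Expr.size, Function.update_apply,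
      childAddr, hr12, hr13, hm, ho, hc, ht]
    refine ⟨fun x h h' h'' => by simp [h, h', h'', hr], by simp [add_assoc], by simp; omega, trivial,
      trivial, by omega, ?_⟩
    rw [Nat.succ_mul]
    omega

theorem reaches_vote (K : List Cmd) (s : State I.n) (h0 : s.reg 0 = I.n) {ρ : ℕ}
    (h6 : s.reg 6 = ρ) :
    Reaches ora τ (voteCmd :: K, s) (yesCount (ora (s.setAt (s.reg 8 + I.n + 1))) ρ)
      fun v y => ∃ s', y = (K, s') ∧
      (∀ x < 10, s'.reg x = s.reg x) ∧ s'.reg 12 = v ∧ s'.mem = s.mem ∧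
      s'.out = s.out ∧ s'.calls = s.calls + ρ ∧
      s'.time = s.time + ρ * (I.n + τ + 18) + 8 := by
  rw [← PMF.map_id (yesCount _ _), ← PMF.bind_pure_comp]
  refine Reaches.of_leads (leads_seq.trans (leads_assign.trans (leads_seq.trans leads_assign)))
    (Reaches.bind (reaches_voteLoop (i := ρ) K _ ?_ ?_) ?_)
  · simpa [State.tick, State.setReg]
  · simp [State.tick, State.setReg, Expr.eval, h6]
  · rintro v y ⟨s₁, rfl, hr, hr12, hr13, hm, ho, hc, ht⟩
    have e13 : s₁.reg 13 = 0 := by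
      rw [hr13]
      simp [State.tick, State.setReg, Expr.eval, h6]
    refine Reaches.of_leads (leads_loop_false (by simp [Expr.eval, e13]))
      (Reaches.pure ⟨_, rfl, ?_⟩)
    simp [State.tick, State.setReg, Expr.eval, Expr.size] at hr12 hm ho hc ht hr
    refine ⟨fun x hx => ?_, by simp [State.tick, hr12], hm, ho, hc, ?_⟩
    · have h1 : x ≠ 12 := by omega
      have h2 : x ≠ 13 := by omega
      simp [State.tick, hr x (by omega) h1 h2, h1, h2]
    · simp [State.tick, ht, Expr.size]
      omega

theorem leads_codeLoop (K : List Cmd) (s : State I.n) (h0 : s.reg 0 = I.n) (h10 : s.reg 10 = 0)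
    (h12 : s.reg 12 = 0) (h13 : s.reg 13 = 1) {i : ℕ} (hi : i ≤ I.n) :
    ∃ s', Leads I ora τ (codeLoop :: K, s) (codeLoop :: K, s') ∧ (∀ x < 10, s'.reg x = s.reg x) ∧
      s'.reg 10 = i ∧ s'.reg 13 = 2 ^ i ∧
      s'.reg 12 = ∑ j ∈ Finset.range i, (if s.mem (s.reg 8 + j) ≠ 0 then 2 ^ j else 0) ∧
      s'.mem = s.mem ∧ s'.out = s.out ∧ s'.calls = s.calls ∧ s'.time ≤ s.time + 23 * i := by
  induction i with
  | zero => exact ⟨s, Leads.refl _, by simp [h10, h12, h13]⟩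
  | succ i ih =>
    obtain ⟨s₁, hl, hr, hr10, hr13, hr12, hm, ho, hc, ht⟩ := ih (by omega)
    have e0 : s₁.reg 0 = I.n := by rw [hr 0 (by simp), h0]
    have e8 : s₁.reg 8 = s.reg 8 := hr 8 (by simp)
    have hl := hl.trans ((leads_loop_true (by simp [Expr.eval, e0, hr10]; omega)).trans
      leads_seq)
    by_cases hb : s.mem (s.reg 8 + i) = 0
    · refine ⟨_, hl.trans ((leads_branch_false ?_).trans (leads_assign.trans (leads_seq.trans
        (leads_assign.trans leads_assign)))), ?_⟩
      · simp [Expr.eval, State.tick, e8, hr10, hm, hb]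
      · simp only [State.tick, State.setReg, Expr.eval, Expr.size, Function.update_apply,
          Finset.sum_range_succ, hb, hm, ho, hc, hr12, hr13, hr10]
        refine ⟨fun x hx => ?_, by simp, by simp [pow_succ, mul_two], by simp, trivial, trivial, trivial,
          by omega⟩
        rw [if_neg (by omega), if_neg (by omega), if_neg (by omega), hr x hx]
    · refine ⟨_, hl.trans ((leads_branch_true ?_).trans (leads_assign.trans (leads_seq.trans
        (leads_assign.trans leads_assign)))), ?_⟩
      · simpa [Expr.eval, State.tick, e8, hr10, hm] using hb
      · simp only [State.tick, State.setReg, Expr.eval, Expr.size, Function.update_apply,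
          Finset.sum_range_succ, hm, ho, hc, hr12, hr13, hr10]
        refine ⟨fun x hx => ?_, by simp, by simp [pow_succ, mul_two], by simp [hb], trivial, trivial, trivial,
          by omega⟩
        rw [if_neg (by omega), if_neg (by omega), if_neg (by omega), hr x hx]

theorem code_setAt (s : State I.n) (a : ℕ) : code (s.setAt a) =
    ∑ j ∈ Finset.range I.n, (if s.mem (a + j) ≠ 0 then 2 ^ j else 0) := by
  rw [Finset.sum_range, code, State.setAt, Finset.sum_filter]

theorem leads_code (K : List Cmd) (s : State I.n) (h0 : s.reg 0 = I.n) :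
    ∃ s', Leads I ora τ (codeCmd :: K, s) (K, s') ∧ (∀ x < 10, s'.reg x = s.reg x) ∧
      s'.reg 12 = code (s.setAt (s.reg 8)) ∧
      s'.mem = s.mem ∧ s'.out = s.out ∧ s'.calls = s.calls ∧ s'.time ≤ s.time + 23 * (I.n + 1) := by
  obtain ⟨s₁, hl, hr, hr10, hr13, hr12, hm, ho, hc, ht⟩ :=
    leads_codeLoop (ora := ora) (τ := τ) K ((((((s.tick 1).setReg 10 0).tick 2).tick 1).setReg 12 0
      |>.tick 2 |>.tick 1).setReg 13 1 |>.tick 2)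
      (by simpa [State.tick, State.setReg]) (by simp [State.tick, State.setReg])
      (by simp [State.tick, State.setReg]) (by simp [State.tick, State.setReg]) le_rfl
  refine ⟨_, (leads_seq.trans (leads_assign.trans (leads_seq.trans (leads_assign.trans
    (leads_seq.trans leads_assign))))).trans (hl.trans (leads_loop_false ?_)), ?_⟩
  · simp [Expr.eval, hr10, hr, State.tick, State.setReg, h0]
  · simp [State.tick, State.setReg, Expr.size] at hr hr12 hm ho hc ht ⊢
    rw [code_setAt]
    refine ⟨fun x hx => ?_, by simpa using hr12, hm, ho, hc, by omega⟩
    rw [hr x hx, Function.update_of_ne (by omega), Function.update_of_ne (by omega),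
      Function.update_of_ne (by omega)]

/-- A set is checked only when its mark is still zero, and is marked at once. Hence a witness is
emitted on its first visit and never again. Quantifying over `V` inside keeps the machine part
independent of the history. -/
theorem leads_visit (K : List Cmd) (s : State I.n) (h0 : s.reg 0 = I.n) (h8 : 2 ^ I.n ≤ s.reg 8) :
    ∃ s', Leads I ora τ (visitCmd :: K, s) (K, s') ∧ (∀ x < 10, s'.reg x = s.reg x) ∧
      (∀ x, 2 ^ I.n ≤ x → s'.mem x = s.mem x) ∧
      (∀ V, Table s V → Table s' (insert (s.setAt (s.reg 8)) V)) ∧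
      s'.calls ≤ s.calls + 1 ∧ s'.time ≤ s.time + 50 * (I.n + 1) + τ := by
  obtain ⟨s₁, hl, hr, hr12, hm, ho, hc, ht⟩ := leads_code (ora := ora) (τ := τ)
    (.branch (.load (.reg 12)) skip (.seq (.store (.reg 12) (.lit 1))
    (.seq (.check 11 (.reg 8)) (.branch (.reg 11) (.emit (.reg 8)) skip))) :: K) (s.tick 1)
    (by simpa [State.tick])
  have hl := leads_seq.trans hl
  simp only [State.tick] at hr hr12 hm ho hc ht
  have hset : (⟨s.reg, s.mem, s.out, s.calls, s.time + 1⟩ : State I.n).setAt (s.reg 8) =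
    s.setAt (s.reg 8) := rfl
  rw [hset] at hr12
  have hlt := code_lt (s.setAt (s.reg 8))
  by_cases hv : s.mem (code (s.setAt (s.reg 8))) = 0
  · have hl := hl.trans ((leads_branch_false (by simp [Expr.eval, hr12, hm, hv])).trans
      (leads_seq.trans (leads_store.trans (leads_seq.trans leads_check))))
    have hmem : ∀ x, 2 ^ I.n ≤ x →
        Function.update s₁.mem (s₁.reg 12) 1 x = s.mem x := by
      intro x hx
      rw [Function.update_of_ne (by omega), hm]
    -- The mark is written below `2 ^ n` and the frame lies above, so the current set is intact when
    -- it is checked and emitted.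
    have hset : ∀ (r : ℕ → ℕ) (o : List (Finset (Fin I.n))) (c t : ℕ),
        (⟨r, Function.update s₁.mem (s₁.reg 12) 1, o, c, t⟩ : State I.n).setAt (s₁.reg 8) =
          s.setAt (s.reg 8) := by
      intro r o c t
      simp only [State.setAt, hr 8 (by simp)]
      refine Finset.filter_congr fun j _ => ?_
      rw [hmem _ (by omega)]
    have hmark : ∀ V, Table s V → ∀ Y, Function.update s₁.mem (s₁.reg 12) 1 (code Y) ≠ 0 ↔
        Y ∈ insert (s.setAt (s.reg 8)) V := by
      intro V hV Y
      rw [hr12, hm, Function.update_apply]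
      by_cases hY : Y = s.setAt (s.reg 8)
      · simp [hY]
      · simpa [hY, code_injective.eq_iff] using hV.mark Y
    by_cases hw : s.setAt (s.reg 8) ∈ I.witnesses
    · refine ⟨_, hl.trans ((leads_branch_true ?_).trans leads_emit), ?_⟩
      · simp [State.tick, State.setReg, State.setMem, State.call, Expr.eval, hset, hw]
      · simp [State.tick, State.setReg, State.setMem, State.call, State.push, Expr.eval, hset,
          Expr.size, hc, ho]
        refine ⟨fun x hx => ?_, hmem, fun V hV => ⟨hmark V hV, ?_, ?_⟩, by omega⟩
        · rw [Function.update_of_ne (by omega), hr x hx]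
        · simp only [List.mem_append, List.mem_singleton]
          rintro X (h | rfl)
          · exact hV.witness X h
          · exact hw
        · intro W hW
          have h1 := hV.mark (s.setAt (s.reg 8))
          have h2 := hV.count W hW
          simp only [List.count_append, h2, List.count_singleton, Finset.mem_insert]
          by_cases hWX : W = s.setAt (s.reg 8)
          · subst hWX
            have : s.setAt (s.reg 8) ∉ V := fun h => (h1.2 h) hv
            simp [this]
          · simp [hWX, Ne.symm hWX]
    · refine ⟨_, hl.trans ((leads_branch_false ?_).trans leads_assign), ?_⟩
      · simp [State.tick, State.setReg, State.setMem, State.call, Expr.eval, hset, hw]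
      · simp [State.tick, State.setReg, State.setMem, State.call, Expr.eval, hset,
          Expr.size, hc, ho]
        refine ⟨fun x hx => ?_, hmem, fun V hV => ⟨hmark V hV, hV.witness, ?_⟩, by omega⟩
        · rw [Function.update_of_ne (by omega), hr x hx]
        · intro W hW
          have : W ≠ s.setAt (s.reg 8) := fun h => hw (h ▸ hW)
          simp [hV.count W hW, this]
  · refine ⟨_, hl.trans ((leads_branch_true (by simpa [Expr.eval, hr12, hm] using hv)).trans
      leads_assign), ?_⟩
    simp [State.tick, State.setReg, Expr.eval, Expr.size, hm, hc]
    refine ⟨fun x hx => ?_, fun V hV => ?_, by omega⟩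
    · rw [Function.update_of_ne (by omega), hr x hx]
    · have h1 : insert (s.setAt (s.reg 8)) V = V :=
        Finset.insert_eq_of_mem ((hV.mark _).1 hv)
      rw [h1]
      exact hV.congr (fun _ _ => rfl) ho

end verify

/-! ### The depth-first search realises the recursive process `explore` -/

section search

open Prog

variable {I : Instance} {ora : Finset (Fin I.n) → PMF Bool} {τ R D ρ : ℕ}

/-- The registers that are constant during the search have their intended values. -/
structure Ready (I : Instance) (R D ρ : ℕ) (s : State I.n) : Prop where
  card : s.reg 0 = I.n
  branching : s.reg 3 = R
  levels : s.reg 5 = D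
  votes : s.reg 6 = ρ

theorem Ready.congr {s s' : State I.n} (h : Ready I R D ρ s) (hr : ∀ x < 7, s'.reg x = s.reg x) :
    Ready I R D ρ s' where
  card := by rw [hr 0 (by simp), h.card]
  branching := by rw [hr 3 (by simp), h.branching]
  levels := by rw [hr 5 (by simp), h.levels]
  votes := by rw [hr 6 (by simp), h.votes]

/-- The time charged for a unit of work. -/
def unitTime (n ρ τ : ℕ) : ℕ := 200 * (n + 1) + (ρ + 1) * (n + τ + 18)

/-- What a part of the search with outcome `r` does to the state. -/
structure Effect (ρ τ : ℕ) (s s' : State I.n) (r : Outcome I.n) : Prop where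
  reg : ∀ x < 8, s'.reg x = s.reg x
  calls : s'.calls ≤ s.calls + (ρ + 1) * r.2
  time : s'.time ≤ s.time + unitTime I.n ρ τ * r.2
  table : ∀ V, Table s V → Table s' (V ∪ r.1)

theorem Effect.trans {s s' s'' : State I.n} {r r' : Outcome I.n} (h : Effect ρ τ s s' r)
    (h' : Effect ρ τ s' s'' r') : Effect ρ τ s s'' (r.join r') where
  reg x hx := by rw [h'.reg x hx, h.reg x hx]
  calls := by
    have h1 := h.calls
    have h2 := h'.calls
    simp only [Outcome.join, Nat.mul_add]
    omega
  time := by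
    have h1 := h.time
    have h2 := h'.time
    simp only [Outcome.join, Nat.mul_add]
    omega
  table V hV := by
    have := h'.table _ (h.table V hV)
    rwa [Finset.union_assoc] at this

theorem Outcome.join_unit {n : ℕ} (r : Outcome n) : Outcome.join (∅, 1) r = r.succ := by
  simp [Outcome.join, Outcome.succ, add_comm]

theorem Outcome.succ_join {n : ℕ} (r r' : Outcome n) : (r.join r').succ = r.join r'.succ := by
  simp [Outcome.join, Outcome.succ, add_assoc]

theorem leads_pop (K : List Cmd) (s : State I.n) (h0 : s.reg 0 = I.n) :
    ∃ s', Leads I ora τ (pop :: K, s) (K, s') ∧ s'.reg 8 = s.reg 8 - (I.n + 1) ∧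
      s'.reg 9 = s.reg 9 + 1 ∧ (∀ x < 8, s'.reg x = s.reg x) ∧ s'.mem = s.mem ∧
      s'.out = s.out ∧ s'.calls = s.calls ∧ s'.time = s.time + 11 := by
  refine ⟨_, leads_seq.trans (leads_assign.trans leads_assign), ?_⟩
  simp [State.tick, State.setReg, Expr.eval, Expr.size, h0]
  intro x hx
  rw [Function.update_of_ne (by omega), Function.update_of_ne (by omega)]

theorem setAt_congr {s s' : State I.n} {a : ℕ} (h : ∀ x, a ≤ x → x < a + I.n → s'.mem x = s.mem x) :
    s'.setAt a = s.setAt a := by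
  unfold State.setAt
  exact Finset.filter_congr fun j _ => by rw [h _ (by omega) (by omega)]

/-- This separates what `expand` itself executes, the thinning and the vote, from the recursive
search; of the vote only the decision is kept. -/
theorem trial_eq {n : ℕ} (ora : Finset (Fin n) → PMF Bool) (ρ : ℕ)
    (next : Finset (Fin n) → PMF (Outcome n)) (X : Finset (Fin n)) :
    trial ora ρ next X = ((randomSubset n).bind fun F => (yesCount (ora (thin X F)) ρ).map
      fun v => (F, decide (ρ < v + v))).bind fun p =>
        if p.2 then (next (thin X p.1)).map Outcome.succ else PMF.pure (∅, 1) := by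
  simp [trial, majority, PMF.bind_bind, PMF.bind_map, Function.comp_def]

/-- Everything below the trial counter is preserved, so ancestors on the stack keep their sets and
counters. After a negative vote the contents of the child frame are irrelevant. -/
theorem reaches_expand (K : List Cmd) (s : State I.n) (hs : Ready I R D ρ s) :
    Reaches ora τ (expand :: K, s) ((randomSubset I.n).bind fun F =>
      (yesCount (ora (thin (s.setAt (s.reg 8)) F)) ρ).map fun v => (F, decide (ρ < v + v)))
      fun p y => ∃ s', y = (K, s') ∧ (∀ x < 8, s'.reg x = s.reg x) ∧
      (∀ x < s.reg 8 + I.n, s'.mem x = s.mem x) ∧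
      s'.mem (s.reg 8 + I.n) = s.mem (s.reg 8 + I.n) - 1 ∧
      (p.2 = true → s'.reg 8 = s.reg 8 + I.n + 1 ∧ s'.reg 9 = s.reg 9 - 1 ∧
        s'.setAt (s.reg 8 + I.n + 1) = thin (s.setAt (s.reg 8)) p.1 ∧
        s'.mem (s.reg 8 + I.n + 1 + I.n) = R) ∧
      (p.2 = false → s'.reg 8 = s.reg 8 ∧ s'.reg 9 = s.reg 9) ∧
      s'.out = s.out ∧ s'.calls = s.calls + ρ ∧
      s'.time ≤ s.time + 27 * (I.n + 1) + ρ * (I.n + τ + 18) + 55 := by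
  have h0 := hs.card
  refine Reaches.of_leads (leads_seq.trans (leads_store.trans leads_seq)) ?_
  set s₀ : State I.n := (((s.tick 1).setMem (counterAddr.eval (s.tick 1))
    (((Expr.load counterAddr).sub (Expr.lit 1)).eval (s.tick 1))).tick
      (counterAddr.size + ((Expr.load counterAddr).sub (Expr.lit 1)).size + 1)).tick 1 with hs₀
  have hreg : s₀.reg = s.reg := rfl
  have hout : s₀.out = s.out := rfl
  have hcalls : s₀.calls = s.calls := rfl
  have htime : s₀.time = s.time + 12 := by
    simp [hs₀, State.tick, State.setMem, counterAddr, Expr.size]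
  have hmem : s₀.mem = Function.update s.mem (s.reg 8 + I.n) (s.mem (s.reg 8 + I.n) - 1) := by
    simp [hs₀, State.tick, State.setMem, counterAddr, Expr.eval, h0]
  have hset : s₀.setAt (s.reg 8) = s.setAt (s.reg 8) := by
    refine setAt_congr fun x _ hx => ?_
    rw [hmem, Function.update_of_ne (by omega)]
  refine (reaches_thin _ s₀ (by rw [hreg, h0])).bind ?_
  rintro F y ⟨s₁, rfl, hr₁, hX, hlow, ho₁, hc₁, ht₁⟩
  rw [hreg, hset] at hX
  rw [hreg] at hr₁ hlow
  refine Reaches.of_leads leads_seq ?_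
  rw [← PMF.bind_pure_comp]
  have hset₁ : (s₁.tick 1).setAt ((s₁.tick 1).reg 8 + I.n + 1) =
      thin (s.setAt (s.reg 8)) F := by
    rw [← hX]
    simp [State.setAt, State.tick, hr₁]
  rw [← hset₁]
  refine (reaches_vote (ρ := ρ) _ (s₁.tick 1) (by simp [State.tick, hr₁, h0])
    (by simp [State.tick, hr₁, hs.votes])).bind ?_
  rintro v y ⟨s₂, rfl, hr₂, h12, hm₂, ho₂, hc₂, ht₂⟩
  simp only [State.tick] at hr₂ hm₂ ho₂ hc₂ ht₂
  have hr : ∀ x < 10, s₂.reg x = s.reg x := fun x hx => by rw [hr₂ x hx, hr₁ x hx]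
  have e6 : s₂.reg 6 = ρ := by rw [hr 6 (by simp), hs.votes]
  have e0 : s₂.reg 0 = I.n := by rw [hr 0 (by simp), h0]
  by_cases hv : ρ < v + v
  · refine Reaches.of_leads ((leads_branch_true ?_).trans (leads_seq.trans (leads_assign.trans
      (leads_seq.trans (leads_assign.trans leads_store))))) (Reaches.pure ⟨_, rfl, ?_⟩)
    · simp [Expr.eval, h12, e6]
      omega
    · simp [State.tick, State.setReg, State.setMem, Expr.eval, Expr.size, childAddr, counterAddr,
        e0, hr, hv, hm₂, hs.branching, ho₂, ho₁, hout, hc₂, hc₁, hcalls, ht₂]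
      refine ⟨fun x hx => ?_, fun x hx => ?_, ?_, ?_, ?_⟩
      · rw [Function.update_of_ne (by omega), Function.update_of_ne (by omega), hr x (by omega)]
      · rw [Function.update_of_ne (by omega), hlow x (by omega), hmem,
          Function.update_of_ne (by omega)]
      · rw [Function.update_of_ne (by omega), hlow _ (by omega), hmem, Function.update_self]
      · rw [← hX]
        refine setAt_congr fun x _ hx => ?_
        exact Function.update_of_ne (by omega) _ _
      · omega
  · refine Reaches.of_leads ((leads_branch_false ?_).trans leads_assign) (Reaches.pure ⟨_, rfl, ?_⟩)
    · simp [Expr.eval, h12, e6]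
      omega
    · simp [State.tick, State.setReg, Expr.eval, Expr.size, hr, hv, hm₂, ho₂, ho₁, hout, hc₂, hc₁,
        hcalls, ht₂]
      refine ⟨fun x hx => ?_, fun x hx => ?_, ?_, ?_⟩
      · rw [Function.update_of_ne (by omega), hr x (by omega)]
      · rw [hlow x (by omega), hmem, Function.update_of_ne (by omega)]
      · rw [hlow _ (by omega), hmem, Function.update_self]
      · omega

/-- The relation between the state `s` when a frame of height `d` is entered and the configuration
`y` after it has been left, if the search below the frame has the outcome `r`. -/
def Left (ρ τ : ℕ) (K : List Cmd) (s : State I.n) (d : ℕ) (r : Outcome I.n) (y : Config I.n) :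
    Prop :=
  ∃ s', y = (search :: K, s') ∧ Effect ρ τ s s' r ∧ s'.reg 8 = s.reg 8 - (I.n + 1) ∧
    s'.reg 9 = d + 1 ∧ ∀ x, 2 ^ I.n ≤ x → x < s.reg 8 → s'.mem x = s.mem x

/-- The state on entry to a frame of height `d` for the set `X` with `j` trials left. -/
structure Entered (I : Instance) (R D ρ d j : ℕ) (X : Finset (Fin I.n)) (s : State I.n) : Prop where
  ready : Ready I R D ρ s
  frame : 2 ^ I.n ≤ s.reg 8
  height : s.reg 9 = d
  le : d ≤ D
  set : s.setAt (s.reg 8) = X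
  counter : s.mem (s.reg 8 + I.n) = j

/-- A leaf makes at most one call, and its traversal of the set fits into one unit of work. -/
theorem reaches_leaf (K : List Cmd) {s : State I.n} {X : Finset (Fin I.n)} {j : ℕ}
    (hs : Entered I R D ρ 0 j X s) :
    Reaches ora τ (search :: K, s) (explore ora R ρ 0 X) (Left ρ τ K s 0) := by
  have h0 := hs.ready.card
  have hl : Leads I ora τ (search :: K, s) _ :=
    (leads_loop_true (by simp [Expr.eval, hs.height])).trans
    ((leads_branch_false (by simp [Expr.eval, State.tick, hs.height])).trans leads_seq)
  set s₀ := ((s.tick (((Expr.reg 5).add (Expr.lit 1)).sub (Expr.reg 9)).size.succ).tick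
    ((Expr.reg 9).size + 1)).tick 1 with hs₀
  obtain ⟨s₁, hl₁, hr₁, hm₁, hV₁, hc₁, ht₁⟩ := leads_visit (ora := ora) (τ := τ)
    (pop :: search :: K) s₀ h0 hs.frame
  obtain ⟨s₂, hl₂, h8, h9, hr₂, hm₂, ho₂, hc₂, ht₂⟩ := leads_pop (ora := ora) (τ := τ)
    (search :: K) s₁ (by rw [hr₁ 0 (by simp)]; exact h0)
  have htime : s₀.time = s.time + 9 := by simp [hs₀, State.tick, Expr.size]
  refine Reaches.of_leads (hl.trans (hl₁.trans hl₂)) (Reaches.pure ⟨s₂, rfl, ⟨?_, ?_, ?_, ?_⟩,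
    ?_, ?_, ?_⟩)
  · intro x hx
    rw [hr₂ x hx, hr₁ x (by omega)]
    rfl
  · have : s₀.calls = s.calls := rfl
    simp only [mul_one]
    omega
  · simp only [mul_one, unitTime]
    -- The single check is paid for by the vote term of `unitTime`.
    have : I.n + τ + 18 ≤ (ρ + 1) * (I.n + τ + 18) := Nat.le_mul_of_pos_left _ (by omega)
    omega
  · intro V hV
    have h := hV₁ V (hV.congr (fun _ _ => rfl) rfl)
    have e : s₀.setAt (s₀.reg 8) = X := hs.set
    rw [e] at h
    rw [Finset.union_comm]
    exact h.congr (fun x _ => by rw [hm₂]) ho₂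
  · rw [h8, hr₁ 8 (by simp)]
    rfl
  · rw [h9, hr₁ 9 (by simp)]
    exact congrArg (· + 1) hs.height
  · intro x hx _
    rw [hm₂, hm₁ x hx]
    rfl

/-- The inner induction, on the number of trials left; `ih` is the outer hypothesis for the height
below. A child search returns with the stack pointer and all lower frames restored, so the parent
resumes with its counter reduced by one. -/
theorem reaches_trials {d : ℕ} (K : List Cmd)
    (ih : ∀ {s : State I.n} {X : Finset (Fin I.n)}, Entered I R D ρ d R X s →
      Reaches ora τ (search :: K, s) (explore ora R ρ d X) (Left ρ τ K s d))
    {s : State I.n} {X : Finset (Fin I.n)} {j : ℕ} (hs : Entered I R D ρ (d + 1) j X s) :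
    Reaches ora τ (search :: K, s)
      ((repeated (trial ora ρ (explore ora R ρ d) X) j).map Outcome.succ)
      (Left ρ τ K s (d + 1)) := by
  induction j generalizing s with
  | zero =>
    have h0 := hs.ready.card
    have hle := hs.le
    have hl : Leads I ora τ (search :: K, s) _ :=
      (leads_loop_true (by simp [Expr.eval, hs.height, hs.ready.levels]; omega)).trans
      ((leads_branch_true (by simp [Expr.eval, State.tick, hs.height])).trans
      (leads_branch_false (by simp [Expr.eval, State.tick, counterAddr, h0, hs.counter])))
    obtain ⟨s₂, hl₂, h8, h9, hr₂, hm₂, ho₂, hc₂, ht₂⟩ := leads_pop (ora := ora) (τ := τ)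
      (search :: K) (((s.tick ((((Expr.reg 5).add (Expr.lit 1)).sub (Expr.reg 9)).size + 1)).tick
        ((Expr.reg 9).size + 1)).tick ((Expr.load counterAddr).size + 1)) h0
    refine Reaches.of_leads (hl.trans hl₂) ?_
    rw [repeated, PMF.pure_map]
    refine Reaches.pure ⟨s₂, rfl, ⟨hr₂, ?_, ?_, ?_⟩, h8, ?_, ?_⟩
    · rw [hc₂]
      simp [State.tick]
    · simp only [ht₂, State.tick, Expr.size, Outcome.succ, unitTime, counterAddr]
      omega
    · intro V hV
      simp only [Outcome.succ, Finset.union_empty]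
      exact hV.congr (fun x _ => by rw [hm₂]; rfl) ho₂
    · rw [h9]
      exact congrArg (· + 1) hs.height
    · intro x _ _
      rw [hm₂]
      rfl
  | succ j ihj =>
    have h0 := hs.ready.card
    have hle := hs.le
    have hfr := hs.frame
    -- The unit for leaving the frame is moved behind the last trial, where the machine spends it.
    have e : (repeated (trial ora ρ (explore ora R ρ d) X) (j + 1)).map Outcome.succ =
        (trial ora ρ (explore ora R ρ d) X).bind fun r =>
          ((repeated (trial ora ρ (explore ora R ρ d) X) j).map Outcome.succ).map r.join := by
      simp [repeated, PMF.map_bind, PMF.map_comp, Function.comp_def, Outcome.succ_join]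
    rw [e]
    -- One trial, including any search below the child, leads back to the same frame.
    have mid : Reaches ora τ (search :: K, s) (trial ora ρ (explore ora R ρ d) X) fun r y =>
        ∃ s', y = (search :: K, s') ∧ Effect ρ τ s s' r ∧ s'.reg 8 = s.reg 8 ∧
          s'.reg 9 = s.reg 9 ∧ (∀ x, 2 ^ I.n ≤ x → x < s.reg 8 + I.n → s'.mem x = s.mem x) ∧
          s'.mem (s.reg 8 + I.n) = j := by
      refine Reaches.of_leads
        ((leads_loop_true (by simp [Expr.eval, hs.height, hs.ready.levels]; omega)).trans
        ((leads_branch_true (by simp [Expr.eval, State.tick, hs.height])).trans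
        (leads_branch_true (by simp [Expr.eval, State.tick, counterAddr, h0, hs.counter])))) ?_
      set s₀ : State I.n :=
        ((s.tick ((((Expr.reg 5).add (Expr.lit 1)).sub (Expr.reg 9)).size + 1)).tick
          ((Expr.reg 9).size + 1)).tick ((Expr.load counterAddr).size + 1) with hs₀
      have htime : s₀.time = s.time + 13 := by
        simp [hs₀, State.tick, Expr.size, counterAddr]
      rw [trial_eq]
      have hX : X = s₀.setAt (s₀.reg 8) := hs.set.symm
      rw [hX]
      refine (reaches_expand _ s₀ (hs.ready.congr fun _ _ => rfl)).bind ?_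
      rintro ⟨F, b⟩ y ⟨s₁, rfl, hr₁, hm₁, hj₁, htrue, hfalse, ho₁, hc₁, ht₁⟩
      have e8 : s₀.reg 8 = s.reg 8 := rfl
      have e9 : s₀.reg 9 = s.reg 9 := rfl
      have em : s₀.mem = s.mem := rfl
      simp only [e8, e9, em] at hm₁ hj₁ htrue hfalse
      have heff : Effect ρ τ s s₁ (∅, 1) := by
        refine ⟨hr₁, ?_, ?_, fun V hV => ?_⟩
        · have : s₀.calls = s.calls := rfl
          simp only [mul_one]
          omega
        · have : (ρ + 1) * (I.n + τ + 18) = ρ * (I.n + τ + 18) + (I.n + τ + 18) := by ring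
          simp only [mul_one, unitTime]
          omega
        · simp only [Finset.union_empty]
          exact hV.congr (fun x hx => hm₁ x (by omega)) ho₁
      have hcnt : s₁.mem (s.reg 8 + I.n) = j := by
        rw [hj₁, hs.counter]
        omega
      cases b
      · obtain ⟨h8, h9⟩ := hfalse rfl
        exact Reaches.pure ⟨s₁, rfl, heff, h8, h9, fun x _ hx => hm₁ x hx, hcnt⟩
      · obtain ⟨h8, h9, hset, hR⟩ := htrue rfl
        simp only [if_true]
        have hent : Entered I R D ρ d R (thin (s₀.setAt (s.reg 8)) F) s₁ :=
          ⟨hs.ready.congr fun x hx => hr₁ x (by omega), by omega, by rw [h9, hs.height]; rfl,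
            by omega, by rw [h8]; exact hset, by rw [h8]; exact hR⟩
        refine (ih hent).map ?_
        rintro r y ⟨s₂, rfl, heff₂, h8₂, h9₂, hm₂⟩
        refine ⟨s₂, rfl, ?_, by omega, by rw [h9₂, hs.height], ?_, ?_⟩
        · rw [← Outcome.join_unit]
          exact heff.trans heff₂
        · intro x hx hx'
          rw [hm₂ x hx (by omega), hm₁ x hx']
        · rw [hm₂ _ (by omega) (by omega), hcnt]
    refine mid.bind ?_
    rintro r y ⟨s₁, rfl, heff, h8, h9, hm, hj⟩
    have hent : Entered I R D ρ (d + 1) j X s₁ :=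
      ⟨hs.ready.congr fun x hx => heff.reg x (by omega), by rw [h8]; exact hs.frame,
        by rw [h9, hs.height], hs.le,
        by rw [h8, ← hs.set]; exact setAt_congr fun x hx hx' => hm x (by omega) hx',
        by rw [h8]; exact hj⟩
    refine (ihj hent).map ?_
    rintro r' y ⟨s₂, rfl, heff₂, h8₂, h9₂, hm₂⟩
    exact ⟨s₂, rfl, heff.trans heff₂, by rw [h8₂, h8], h9₂,
      fun x hx hx' => by rw [hm₂ x hx (by omega), hm x hx (by omega)]⟩

theorem reaches_search (K : List Cmd) {d : ℕ} {s : State I.n} {X : Finset (Fin I.n)}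
    (hs : Entered I R D ρ d R X s) :
    Reaches ora τ (search :: K, s) (explore ora R ρ d X) (Left ρ τ K s d) := by
  induction d generalizing s X with
  | zero => exact reaches_leaf K hs
  | succ d ih => exact reaches_trials K ih hs

end search

/-! ### Rounds, computation of the parameters, and the whole program -/

section whole

open Prog

variable {I : Instance} {ora : Finset (Fin I.n) → PMF Bool} {τ R D ρ : ℕ}

theorem leads_fillLoop (K : List Cmd) (s : State I.n) (h0 : s.reg 0 = I.n) (h10 : s.reg 10 = 0)
    {i : ℕ} (hi : i ≤ I.n) :
    ∃ s', Leads I ora τ (fillLoop :: K, s) (fillLoop :: K, s') ∧ (∀ x < 10, s'.reg x = s.reg x) ∧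
      s'.reg 10 = i ∧ (∀ x < s.reg 4, s'.mem x = s.mem x) ∧ (∀ j < i, s'.mem (s.reg 4 + j) ≠ 0) ∧
      s'.out = s.out ∧ s'.calls = s.calls ∧ s'.time = s.time + 14 * i := by
  induction i with
  | zero => exact ⟨s, Leads.refl _, by simp [h10]⟩
  | succ i ih =>
    obtain ⟨s₁, hl, hr, hr10, hm, hm', ho, hc, ht⟩ := ih (by omega)
    have e0 : s₁.reg 0 = I.n := by rw [hr 0 (by simp), h0]
    have e4 : s₁.reg 4 = s.reg 4 := hr 4 (by simp)
    refine ⟨_, hl.trans ((leads_loop_true (by simp [Expr.eval, e0, hr10]; omega)).trans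
      (leads_seq.trans (leads_store.trans leads_assign))), ?_⟩
    simp only [State.tick, State.setReg, State.setMem, Expr.eval, Expr.size, Function.update_apply,
      e4, hr10, ho, hc, ht]
    refine ⟨fun x hx => ?_, by simp, fun x hx => ?_, fun j hj => ?_, trivial, trivial, by omega⟩
    · rw [if_neg (by omega), hr x hx]
    · rw [if_neg (by omega), hm x hx]
    · rcases Nat.lt_succ_iff_lt_or_eq.1 hj with hj | rfl
      · rw [if_neg (by omega)]
        exact hm' j hj
      · simp

theorem leads_fill (K : List Cmd) (s : State I.n) (h0 : s.reg 0 = I.n) :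
    ∃ s', Leads I ora τ (fill :: K, s) (K, s') ∧ (∀ x < 10, s'.reg x = s.reg x) ∧
      (∀ x < s.reg 4, s'.mem x = s.mem x) ∧ s'.setAt (s.reg 4) = Finset.univ ∧
      s'.out = s.out ∧ s'.calls = s.calls ∧ s'.time = s.time + 14 * I.n + 7 := by
  obtain ⟨s₁, hl, hr, hr10, hm, hm', ho, hc, ht⟩ := leads_fillLoop (ora := ora) (τ := τ) K
    (((s.tick 1).setReg 10 0).tick 2) (by simpa [State.tick, State.setReg])
    (by simp [State.tick, State.setReg]) le_rfl
  refine ⟨_, (leads_seq.trans leads_assign).trans (hl.trans (leads_loop_false ?_)), ?_⟩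
  · simp [Expr.eval, hr10, hr, State.tick, State.setReg, h0]
  · simp [State.tick, State.setReg, Expr.size] at hr hm hm' ho hc ht ⊢
    refine ⟨fun x hx => ?_, hm, ?_, ho, hc, by omega⟩
    · rw [hr x hx, Function.update_of_ne (by omega)]
    · simp only [State.setAt, Finset.filter_eq_self]
      intro j _
      exact hm' j j.2

theorem reaches_round (K : List Cmd) (s : State I.n) (hs : Ready I R D ρ s)
    (h4 : s.reg 4 = 2 ^ I.n) :
    Reaches ora τ (round :: K, s) (explore ora R ρ D Finset.univ) fun r y => ∃ s', y = (K, s') ∧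
      (∀ x < 7, s'.reg x = s.reg x) ∧ s'.reg 7 = s.reg 7 - 1 ∧
      (∀ V, Table s V → Table s' (V ∪ r.1)) ∧ s'.calls ≤ s.calls + (ρ + 1) * r.2 ∧
      s'.time ≤ s.time + unitTime I.n ρ τ * r.2 + 50 * (I.n + 1) := by
  have h0 := hs.card
  have hl : Leads I ora τ (round :: K, s) _ := leads_seq.trans (leads_assign.trans leads_seq)
  obtain ⟨s₁, hl₁, hr, hm, hset, ho, hc, ht⟩ := leads_fill (ora := ora) (τ := τ)
    (.seq (.assign 8 (.reg 4)) (.seq (.assign 9 (.reg 5))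
      (.seq (.store counterAddr (.reg 3)) search)) :: K)
    ((((s.tick 1).setReg 7 (s.reg 7 - 1)).tick 4).tick 1) (by simpa [State.tick, State.setReg])
  refine Reaches.of_leads (hl.trans (hl₁.trans (leads_seq.trans (leads_assign.trans
    (leads_seq.trans (leads_assign.trans (leads_seq.trans leads_store))))))) ?_
  simp only [State.tick, State.setReg, State.setMem, Expr.eval, Expr.size, counterAddr,
    Function.update_apply] at hr hm hset ho hc ht ⊢
  simp [hr, h0, h4, hs.branching, hs.levels] at hset hm ⊢
  have hA : ∀ {s' : State I.n}, Entered I R D ρ D R Finset.univ s' →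
    Reaches ora τ (search :: K, s') (explore ora R ρ D Finset.univ) (Left ρ τ K s' D) :=
    fun h => reaches_search K h
  rw [← PMF.map_id (explore ora R ρ D Finset.univ), ← PMF.bind_pure_comp]
  refine (hA ⟨⟨?_, ?_, ?_, ?_⟩, ?_, ?_, le_rfl, ?_, ?_⟩).bind ?_
  · simp [hr, h0]
  · simp [hr, hs.branching]
  · simp [hr, hs.levels]
  · simp [hr, hs.votes]
  · simp
  · simp
  · rw [← hset]
    simp only [Function.update_apply]
    simp
    refine setAt_congr fun x _ hx => ?_
    exact Function.update_of_ne (by omega) _ _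
  · simp
  · rintro r y ⟨s₂, rfl, heff, h8, h9, -⟩
    have hreg := heff.reg
    have h5 := hreg 5 (by simp)
    have hcalls := heff.calls
    have htime := heff.time
    simp [Function.update_apply, hr, hs.levels] at hreg h5 hcalls htime
    -- The root has been popped: the height is `D + 1` and the guard of `search` vanishes.
    refine Reaches.of_leads (leads_loop_false (by simp [Expr.eval, h5, h9]))
      (Reaches.pure ⟨_, rfl, ?_⟩)
    simp only [State.tick, Expr.size]
    refine ⟨fun x hx => ?_, ?_, fun V hV => ?_, ?_, ?_⟩
    · rw [hreg x (by omega), if_neg (by omega), if_neg (by omega), hr x (by omega),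
        if_neg (by omega)]
    · rw [hreg 7 (by omega)]
      simp [hr]
    · have := heff.table V (hV.congr (fun x hx => ?_) ho)
      · exact this.congr (fun _ _ => rfl) rfl
      · show Function.update s₁.mem (2 ^ I.n + I.n) R x = _
        rw [Function.update_of_ne (by omega), hm x hx]
    · simp only [id]
      omega
    · simp only [id]
      omega

theorem reaches_rounds (K : List Cmd) (s : State I.n) (hs : Ready I R D ρ s)
    (h4 : s.reg 4 = 2 ^ I.n) {j : ℕ} (hj : s.reg 7 = j) :
    Reaches ora τ (rounds :: K, s) (repeated (explore ora R ρ D Finset.univ) j)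
      fun r y => ∃ s', y = (K, s') ∧ (∀ V, Table s V → Table s' (V ∪ r.1)) ∧
      s'.calls ≤ s.calls + (ρ + 1) * r.2 ∧
      s'.time ≤ s.time + unitTime I.n ρ τ * r.2 + 52 * (I.n + 1) * j + 2 := by
  induction j generalizing s with
  | zero =>
    refine Reaches.of_leads (leads_loop_false (by simp [Expr.eval, hj]))
      (Reaches.pure ⟨_, rfl, ?_⟩)
    simp [State.tick, Expr.size]
    exact fun V hV => hV.congr (fun _ _ => rfl) rfl
  | succ j ih =>
    refine Reaches.of_leads (leads_loop_true (by simp [Expr.eval, hj])) ?_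
    refine (reaches_round _ (s.tick 2) (hs.congr fun _ _ => rfl) h4).bind ?_
    rintro r y ⟨s₁, rfl, hr, hr7, hV₁, hc₁, ht₁⟩
    simp only [State.tick] at hr hr7 hc₁ ht₁
    refine (ih s₁ (hs.congr hr) (by rw [hr 4 (by simp), h4]) (by rw [hr7, hj]; rfl)).map ?_
    rintro r' y ⟨s₂, rfl, hV₂, hc₂, ht₂⟩
    refine ⟨s₂, rfl, fun V hV => ?_, ?_, ?_⟩
    · have := hV₂ _ (hV₁ V (hV.congr (fun _ _ => rfl) rfl))
      rwa [Finset.union_assoc] at this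
    · simp only [Outcome.join, Nat.mul_add]
      omega
    · simp only [Outcome.join, Nat.mul_add]
      simp only [Nat.mul_add] at ht₁ ht₂
      omega

theorem leads_powLoop (K : List Cmd) (s : State I.n) {y i : ℕ} (hy : y ≠ 10) (hi : i ≤ s.reg 10) :
    ∃ s', Leads I ora τ (powLoop y :: K, s) (powLoop y :: K, s') ∧
      (∀ x, x ≠ y → x ≠ 10 → s'.reg x = s.reg x) ∧ s'.reg y = 2 ^ i * s.reg y ∧
      s'.reg 10 = s.reg 10 - i ∧ s'.mem = s.mem ∧ s'.out = s.out ∧ s'.calls = s.calls ∧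
      s'.time = s.time + 11 * i := by
  induction i with
  | zero => exact ⟨s, Leads.refl _, by simp⟩
  | succ i ih =>
    obtain ⟨s₁, hl, hr, hry, hr10, hm, ho, hc, ht⟩ := ih (by omega)
    refine ⟨_, hl.trans ((leads_loop_true (by simp [Expr.eval, hr10]; omega)).trans
      (leads_seq.trans (leads_assign.trans leads_assign))), ?_⟩
    simp only [State.tick, State.setReg, Expr.eval, Expr.size, Function.update_apply, hry, hr10,
      hm, ho, hc, ht]
    refine ⟨fun x hx hx' => by simp [hx, hx', hr], ?_, ?_, trivial, trivial, trivial, by omega⟩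
    · simp [hy]
      ring
    · simp [hy.symm]
      omega

theorem leads_pow (K : List Cmd) (s : State I.n) {x y : ℕ} (hy : y ≠ 10) :
    ∃ s', Leads I ora τ (pow x y :: K, s) (K, s') ∧
      (∀ z, z ≠ y → z ≠ 10 → s'.reg z = s.reg z) ∧ s'.reg y = 2 ^ s.reg x ∧
      s'.mem = s.mem ∧ s'.out = s.out ∧ s'.calls = s.calls ∧
      s'.time = s.time + 11 * s.reg x + 8 := by
  obtain ⟨s₁, hl, hr, hry, hr10, hm, ho, hc, ht⟩ := leads_powLoop (ora := ora) (τ := τ) K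
    (((((s.tick 1).setReg 10 (s.reg x)).tick 2).tick 1).setReg y 1 |>.tick 2)
    (i := s.reg x) hy (by simp [State.tick, State.setReg, hy.symm])
  refine ⟨_, (leads_seq.trans (leads_assign.trans (leads_seq.trans leads_assign))).trans
    (hl.trans (leads_loop_false ?_)), ?_⟩
  · simp [Expr.eval, hr10, State.tick, State.setReg, hy.symm]
  · simp [State.tick, State.setReg, Expr.size] at hr hry hm ho hc ht ⊢
    exact ⟨fun z hz hz' => by simp [hr z hz hz', hz, hz'], hry, hm, ho, hc, by omega⟩

/-- Register `13` runs through the powers of two up to the value of `x`; there are `Nat.size` of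
them. Since `e` depends on neither changing register, every pass adds the same `v`. -/
theorem leads_sizeLoop (K : List Cmd) (s : State I.n) {x y v i : ℕ} {e : Expr} (hx : x ≠ 13)
    (hy : y ≠ 13) (hxy : x ≠ y) (h13 : s.reg 13 = 1)
    (he : ∀ s' : State I.n, (∀ z, z ≠ y → z ≠ 13 → s'.reg z = s.reg z) → e.eval s' = v)
    (hi : i ≤ Nat.size (s.reg x)) :
    ∃ s', Leads I ora τ (sizeLoop x y e :: K, s) (sizeLoop x y e :: K, s') ∧
      (∀ z, z ≠ y → z ≠ 13 → s'.reg z = s.reg z) ∧ s'.reg y = s.reg y + v * i ∧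
      s'.reg 13 = 2 ^ i ∧ s'.mem = s.mem ∧ s'.out = s.out ∧ s'.calls = s.calls ∧
      s'.time = s.time + (14 + e.size) * i := by
  induction i with
  | zero => exact ⟨s, Leads.refl _, by simp [h13]⟩
  | succ i ih =>
    obtain ⟨s₁, hl, hr, hry, hr13, hm, ho, hc, ht⟩ := ih (by omega)
    have hlt : 2 ^ i ≤ s.reg x := Nat.lt_size.1 hi
    refine ⟨_, hl.trans ((leads_loop_true ?_).trans
      (leads_seq.trans (leads_assign.trans leads_assign))), ?_⟩
    · simp only [Expr.eval, hr x hxy hx, hr13]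
      omega
    · refine ⟨fun z hz hz' => ?_, ?_, ?_, ?_, ?_, ?_, ?_⟩
      · simp [State.tick, State.setReg, hz, hz', hr z hz hz']
      · simp only [State.tick, State.setReg, Expr.eval, Function.update_self]
        rw [he _ fun z hz hz' => by simp [hz', hr z hz hz'], Function.update_of_ne hy, hry]
        ring
      · simp [State.tick, State.setReg, Expr.eval, hy.symm, hr13]
        ring
      · simpa [State.tick, State.setReg] using hm
      · simpa [State.tick, State.setReg] using ho
      · simpa [State.tick, State.setReg] using hc
      · simp [State.tick, State.setReg, Expr.size, ht]
        ring

theorem leads_size (K : List Cmd) (s : State I.n) {x y v : ℕ} {e : Expr} (hx : x ≠ 13)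
    (hy : y ≠ 13) (hxy : x ≠ y)
    (he : ∀ s' : State I.n, (∀ z, z ≠ y → z ≠ 13 → s'.reg z = s.reg z) → e.eval s' = v) :
    ∃ s', Leads I ora τ (size x y e :: K, s) (K, s') ∧
      (∀ z, z ≠ y → z ≠ 13 → s'.reg z = s.reg z) ∧ s'.reg y = s.reg y + v * Nat.size (s.reg x) ∧
      s'.mem = s.mem ∧ s'.out = s.out ∧ s'.calls = s.calls ∧
      s'.time = s.time + (14 + e.size) * Nat.size (s.reg x) + 9 := by
  have hreg : (((s.tick 1).setReg 13 1).tick 2).reg x = s.reg x := by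
    simp [State.tick, State.setReg, hx]
  obtain ⟨s₁, hl, hr, hry, hr13, hm, ho, hc, ht⟩ := leads_sizeLoop (ora := ora) (τ := τ) K
    (((s.tick 1).setReg 13 1).tick 2) hx hy hxy (by simp [State.tick, State.setReg])
    (fun s' hs' => he s' fun z hz hz' => by simp [hs' z hz hz', State.tick, State.setReg, hz'])
    le_rfl
  rw [hreg] at hry hr13 ht
  have hlt := Nat.lt_size_self (s.reg x)
  refine ⟨_, (leads_seq.trans leads_assign).trans (hl.trans (leads_loop_false ?_)), ?_⟩
  · simp only [Expr.eval, hr13, hr x hxy hx, hreg]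
    omega
  · simp [State.tick, State.setReg, Expr.size, hy] at hr hry hm ho hc ht ⊢
    exact ⟨fun z hz hz' => by simp [hr z hz hz', hz'], hry, hm, ho, hc, by omega⟩

theorem leads_votesLoop (A : ℕ) (K : List Cmd) (s : State I.n) {i : ℕ} (hi : i ≤ s.reg 10) :
    ∃ s', Leads I ora τ (votesLoop A :: K, s) (votesLoop A :: K, s') ∧
      (∀ x, x ≠ 6 → x ≠ 10 → s'.reg x = s.reg x) ∧ s'.reg 6 = s.reg 6 + A * i ∧
      s'.reg 10 = s.reg 10 - i ∧ s'.mem = s.mem ∧ s'.out = s.out ∧ s'.calls = s.calls ∧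
      s'.time = s.time + 11 * i := by
  induction i with
  | zero => exact ⟨s, Leads.refl _, by simp⟩
  | succ i ih =>
    obtain ⟨s₁, hl, hr, hr6, hr10, hm, ho, hc, ht⟩ := ih (by omega)
    refine ⟨_, hl.trans ((leads_loop_true (by simp [Expr.eval, hr10]; omega)).trans
      (leads_seq.trans (leads_assign.trans leads_assign))), ?_⟩
    simp only [State.tick, State.setReg, Expr.eval, Expr.size, Function.update_apply, hr6, hr10,
      hm, ho, hc, ht]
    refine ⟨fun x hx hx' => by simp [hx, hx', hr], ?_, ?_, trivial, trivial, trivial, by omega⟩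
    · simp
      ring
    · simp
      omega

theorem leads_votes (A : ℕ) (K : List Cmd) (s : State I.n) :
    ∃ s', Leads I ora τ (votes A :: K, s) (K, s') ∧
      (∀ x, x ≠ 6 → x ≠ 10 → s'.reg x = s.reg x) ∧
      s'.reg 6 = s.reg 6 + A * (s.reg 1 + (s.reg 5 + 1)) ∧ s'.mem = s.mem ∧ s'.out = s.out ∧
      s'.calls = s.calls ∧ s'.time = s.time + 11 * (s.reg 1 + (s.reg 5 + 1)) + 9 := by
  obtain ⟨s₁, hl, hr, hr6, hr10, hm, ho, hc, ht⟩ := leads_votesLoop (ora := ora) (τ := τ) A K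
    (((s.tick 1).setReg 10 (s.reg 1 + (s.reg 5 + 1))).tick 6) (i := s.reg 1 + (s.reg 5 + 1))
    (by simp [State.tick, State.setReg])
  refine ⟨_, (leads_seq.trans leads_assign).trans (hl.trans (leads_loop_false ?_)), ?_⟩
  · simp [Expr.eval, hr10, State.tick, State.setReg]
  · simp [State.tick, State.setReg, Expr.size] at hr hr6 hm ho hc ht ⊢
    exact ⟨fun z hz hz' => by simp [hr z hz hz', hz'], hr6, hm, ho, hc, by omega⟩

/-- The number of levels of the search. -/
def numLevels (n : ℕ) : ℕ := 1 + Nat.size n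

/-- The number of answers in a majority vote. -/
def numVotes (A n k : ℕ) : ℕ := A * (k + (numLevels n + 1))

/-- The number of rounds. -/
def numRounds (n m : ℕ) : ℕ := 4 * (numLevels n + 1) * Nat.size m

/-- The outcome of the whole algorithm. -/
noncomputable def enumeration (A : ℕ) {n : ℕ} (k m : ℕ) (ora : Finset (Fin n) → PMF Bool) :
    PMF (Outcome n) :=
  repeated (explore ora (2 ^ k) (numVotes A n k) (numLevels n) Finset.univ) (numRounds n m)

theorem reaches_main (A m : ℕ) :
    Reaches ora τ ([main A], initState I.n I.k m) (enumeration A I.k m ora) fun r y =>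
      ∃ s', y = ([], s') ∧ Table s' r.1 ∧ s'.calls ≤ (numVotes A I.n I.k + 1) * r.2 ∧
        s'.time ≤ unitTime I.n (numVotes A I.n I.k) τ * r.2 + 52 * (I.n + 1) * numRounds I.n m +
          100 * (I.n + I.k + numLevels I.n + Nat.size m + 1) := by
  set s₀ := initState I.n I.k m
  obtain ⟨s₁, hl₁, hr₁, h3, hm₁, ho₁, hc₁, ht₁⟩ := leads_pow (ora := ora) (τ := τ)
    (x := 1) (y := 3) (.seq (pow 0 4) (.seq (.assign 5 (.lit 1)) (.seq (size 0 5 (.lit 1))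
    (.seq (votes A) (.seq (size 2 7 roundsPerDigit) rounds)))) :: []) (s₀.tick 1) (by simp)
  obtain ⟨s₂, hl₂, hr₂, h4, hm₂, ho₂, hc₂, ht₂⟩ := leads_pow (ora := ora) (τ := τ)
    (x := 0) (y := 4) (.seq (.assign 5 (.lit 1)) (.seq (size 0 5 (.lit 1))
    (.seq (votes A) (.seq (size 2 7 roundsPerDigit) rounds))) :: []) (s₁.tick 1) (by simp)
  obtain ⟨s₃, hl₃, hr₃, h5, hm₃, ho₃, hc₃, ht₃⟩ := leads_size (ora := ora) (τ := τ)
    (x := 0) (y := 5) (v := 1) (e := .lit 1)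
    (.seq (votes A) (.seq (size 2 7 roundsPerDigit) rounds) :: [])
    ((((s₂.tick 1).setReg 5 1).tick 2).tick 1) (by simp) (by simp) (by simp)
    (by simp [Expr.eval])
  obtain ⟨s₄, hl₄, hr₄, h6, hm₄, ho₄, hc₄, ht₄⟩ := leads_votes (ora := ora) (τ := τ) A
    (.seq (size 2 7 roundsPerDigit) rounds :: []) (s₃.tick 1)
  obtain ⟨s₅, hl₅, hr₅, h7, hm₅, ho₅, hc₅, ht₅⟩ := leads_size (ora := ora) (τ := τ)
    (x := 2) (y := 7) (v := 4 * (s₄.reg 5 + 1)) (e := roundsPerDigit)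
    (rounds :: []) (s₄.tick 1) (by simp) (by simp) (by simp)
    (by
      intro s' hs'
      simp [Expr.eval, roundsPerDigit, hs', State.tick]
      ring)
  have hl := leads_seq.trans (hl₁.trans (leads_seq.trans (hl₂.trans (leads_seq.trans
    (leads_assign.trans (leads_seq.trans (hl₃.trans (leads_seq.trans (hl₄.trans
    (leads_seq.trans hl₅))))))))))
  simp [State.tick, s₀, initState] at hr₁ h3 hm₁ ho₁ hc₁ ht₁
  simp [State.tick] at hr₂ h4 hm₂ ho₂ hc₂ ht₂
  simp [State.tick, State.setReg, Expr.size] at hr₃ h5 hm₃ ho₃ hc₃ ht₃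
  simp [State.tick] at hr₄ h6 hm₄ ho₄ hc₄ ht₄
  simp [State.tick, Expr.size, roundsPerDigit] at hr₅ h7 hm₅ ho₅ hc₅ ht₅
  have e5 : s₃.reg 5 = numLevels I.n := by
    simp [h5, numLevels, hr₂, hr₁]
  refine Reaches.of_leads hl ?_
  refine (reaches_rounds (R := 2 ^ I.k) (D := numLevels I.n) (ρ := numVotes A I.n I.k) []
    s₅ ⟨?_, ?_, ?_, ?_⟩ ?_ (j := numRounds I.n m) ?_).mono ?_
  · simp [hr₅, hr₄, hr₃, hr₂, hr₁]
  · simp [hr₅, hr₄, hr₃, hr₂, h3]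
  · simp [hr₅, hr₄, e5]
  · simp [hr₅, h6, hr₃, hr₂, hr₁, e5, numVotes]
  · simp [hr₅, hr₄, hr₃, h4, hr₁]
  · simp [h7, hr₄, hr₃, hr₂, hr₁, e5, numRounds]
  · rintro r y ⟨s', rfl, hV, hc, ht⟩
    refine ⟨s', rfl, ?_, ?_, ?_⟩
    -- Zero memory and empty output represent an empty history, so the final table is that of the
    -- sets found.
    · have := hV ∅ ⟨?_, ?_, ?_⟩
      · rwa [Finset.empty_union] at this
      · simp [hm₅, hm₄, hm₃, hm₂, hm₁]
      · simp [ho₅, ho₄, ho₃, ho₂, ho₁]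
      · simp [ho₅, ho₄, ho₃, ho₂, ho₁]
    · omega
    · have e0 : s₁.reg 0 = I.n := by simp [hr₁]
      have e0' : s₂.reg 0 = I.n := by simp [hr₂, hr₁]
      have e1 : s₃.reg 1 = I.k := by simp [hr₃, hr₂, hr₁]
      have e2 : s₄.reg 2 = m := by simp [hr₄, hr₃, hr₂, hr₁]
      rw [e0] at ht₂
      rw [e0'] at ht₃
      rw [e1, e5] at ht₄
      rw [e2] at ht₅
      have : numLevels I.n = 1 + Nat.size I.n := rfl
      omega

end whole

/-! ### Random subsets -/

/-- The last coin matters only if `i ∈ S`: then one of its two values is excluded, which costs a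
factor `1/2`. Otherwise the two halves agree and add up. -/
theorem expect_randomSubset (S : Finset ℕ) (i : ℕ) :
    (expect (randomSubset i) fun F => if S ⊆ F then 1 else 0) =
      if S ⊆ Finset.range i then 2⁻¹ ^ S.card else 0 := by
  induction i generalizing S with
  | zero =>
    by_cases hS : S = ∅
    · simp [randomSubset, hS]
    · simp [randomSubset, hS]
  | succ i ih =>
    simp only [randomSubset, expect_bind, expect_map, expect_coin]
    rw [expect_add, expect_const_mul, expect_const_mul]
    simp only [if_true, Finset.subset_insert_iff, Bool.false_eq_true, if_false]
    rw [ih, ih, Finset.range_add_one]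
    simp only [Finset.subset_insert_iff]
    by_cases hi : i ∈ S
    · have h1 : ¬ S ⊆ Finset.range i := fun h => by simpa using h hi
      rw [if_neg h1, mul_zero, add_zero]
      split_ifs
      · rw [← Finset.card_erase_add_one hi, pow_succ, mul_comm]
      · simp
    · rw [Finset.erase_eq_of_notMem hi, ← add_mul, ENNReal.inv_two_add_inv_two, one_mul]

theorem subset_thin_iff {n : ℕ} {X W : Finset (Fin n)} {F : Finset ℕ} (hW : W ⊆ X) :
    W ⊆ thin X F ↔ W.map Fin.valEmbedding ⊆ F := by
  simp only [thin, Finset.subset_iff, Finset.mem_filter, Finset.mem_map, Fin.valEmbedding_apply,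
    forall_exists_index, and_imp, forall_apply_eq_imp_iff₂]
  exact ⟨fun h u hu => (h hu).2, fun h u hu => ⟨hW hu, h u hu⟩⟩

theorem thin_subset {n : ℕ} (X : Finset (Fin n)) (F : Finset ℕ) : thin X F ⊆ X :=
  Finset.filter_subset _ _

theorem expect_subset_thin {n : ℕ} {X W : Finset (Fin n)} (hW : W ⊆ X) :
    (expect (randomSubset n) fun F => if W ⊆ thin X F then 1 else 0) = 2⁻¹ ^ W.card := by
  simp only [subset_thin_iff hW]
  rw [expect_randomSubset, if_pos, Finset.card_map]
  intro j hj
  obtain ⟨u, -, rfl⟩ := Finset.mem_map.1 hj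
  simp

/-! ### Majority votes -/

theorem apply_eq_expect {α : Type*} [DecidableEq α] (p : PMF α) (a : α) :
    p a = expect p fun x => if x = a then 1 else 0 := by
  unfold expect
  rw [tsum_eq_single a]
  · simp
  · intro b hb
    simp [hb]

/-- The generating function of a binomial law, which is the input to the Chernoff bound. -/
theorem expect_pow_yesCount (q : PMF Bool) (i : ℕ) (x : ℝ≥0∞) :
    (expect (yesCount q i) fun v => x ^ v) = (q true * x + q false) ^ i := by
  induction i with
  | zero => simp [yesCount]
  | succ i ih =>
    simp only [yesCount, expect_bind, expect_map, expect_bool, Bool.toNat_true, Bool.toNat_false,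
      pow_succ, add_zero]
    rw [← ih, ← expect_mul_const]
    congr 1
    funext v
    ring

theorem pmf_bool_add (q : PMF Bool) (a : Bool) : q a + q (!a) = 1 := by
  have h := q.tsum_coe
  rw [tsum_bool] at h
  cases a
  · simpa using h
  · rw [add_comm] at h
    simpa using h

/-- The left side is affine in the error probability with slope `μ - μ⁻¹ ≥ 0`, so the worst case is
error exactly `c`. -/
theorem tilted_le {c μ : ℝ} (hμ : 1 ≤ μ) {q : PMF Bool} {a : Bool} (hc : 0 ≤ c)
    (h : q (!a) ≤ ENNReal.ofReal c) :
    q (!a) * ENNReal.ofReal μ + q a * ENNReal.ofReal μ⁻¹ ≤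
      ENNReal.ofReal (c * μ + (1 - c) * μ⁻¹) := by
  have hp : q (!a) ≠ ∞ := PMF.apply_ne_top _ _
  have hp' : q a ≠ ∞ := PMF.apply_ne_top _ _
  have hsum : (q a).toReal + (q (!a)).toReal = 1 := by
    rw [← ENNReal.toReal_add hp' hp, pmf_bool_add, ENNReal.toReal_one]
  have hle : (q (!a)).toReal ≤ c := ENNReal.toReal_le_of_le_ofReal hc h
  have h0 : 0 ≤ (q (!a)).toReal := ENNReal.toReal_nonneg
  have h0' : 0 ≤ (q a).toReal := ENNReal.toReal_nonneg
  have hμ0 : 0 < μ := by linarith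
  have hinv : μ⁻¹ ≤ 1 := inv_le_one_of_one_le₀ hμ
  rw [← ENNReal.ofReal_toReal hp, ← ENNReal.ofReal_toReal hp', ← ENNReal.ofReal_mul h0,
    ← ENNReal.ofReal_mul h0', ← ENNReal.ofReal_add (by positivity) (by positivity)]
  refine ENNReal.ofReal_le_ofReal ?_
  have : (q a).toReal = 1 - (q (!a)).toReal := by linarith
  rw [this]
  nlinarith

/-- Chernoff's argument: the indicator of a wrong majority is at most the product over all answers
of `μ` for a wrong and `μ⁻¹` for a right one, and independence turns the expectation into a power.
Ties count as negative, so the two cases differ in strictness. -/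
theorem majority_error_le {c μ : ℝ} (hμ : 1 ≤ μ) {q : PMF Bool} {a : Bool} (hc : 0 ≤ c)
    (h : q (!a) ≤ ENNReal.ofReal c) (ρ : ℕ) :
    majority q ρ (!a) ≤ ENNReal.ofReal (c * μ + (1 - c) * μ⁻¹) ^ ρ := by
  refine le_trans ?_ (pow_le_pow_left' (tilted_le hμ hc h) ρ)
  have hμ0 : 0 < μ := by linarith
  set M := ENNReal.ofReal μ with hM
  have hinv : ENNReal.ofReal μ⁻¹ = M⁻¹ := ENNReal.ofReal_inv_of_pos hμ0
  have hM0 : M ≠ 0 := by simpa [hM] using hμ0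
  have hMt : M ≠ ∞ := ENNReal.ofReal_ne_top
  have hM1 : 1 ≤ M := by simpa [hM] using hμ
  have hMM : M * M⁻¹ = 1 := ENNReal.mul_inv_cancel hM0 hMt
  rw [hinv, apply_eq_expect, majority, expect_map]
  cases a
  · simp only [Bool.not_false, decide_eq_true_eq]
    calc (expect (yesCount q ρ) fun v => if ρ < v + v then 1 else 0)
        ≤ expect (yesCount q ρ) fun v => M⁻¹ ^ ρ * (M * M) ^ v := by
          refine expect_mono fun v => ?_
          split_ifs with hv
          · calc (1 : ℝ≥0∞) = M⁻¹ ^ ρ * M ^ ρ := by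
                  rw [← mul_pow, mul_comm, hMM, one_pow]
              _ ≤ M⁻¹ ^ ρ * M ^ (v + v) := by gcongr
              _ = _ := by rw [pow_add, mul_pow]
          · exact zero_le
      _ = (q true * M + q false * M⁻¹) ^ ρ := by
          rw [expect_const_mul, expect_pow_yesCount, ← mul_pow]
          congr 1
          calc M⁻¹ * (q true * (M * M) + q false) = q true * M * (M * M⁻¹) + q false * M⁻¹ := by ring
            _ = _ := by rw [hMM, mul_one]
      _ ≤ _ := le_rfl
  · simp only [Bool.not_true, decide_eq_false_iff_not, not_lt]
    calc (expect (yesCount q ρ) fun v => if v + v ≤ ρ then 1 else 0)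
        ≤ expect (yesCount q ρ) fun v => M ^ ρ * (M⁻¹ * M⁻¹) ^ v := by
          refine expect_mono fun v => ?_
          split_ifs with hv
          · calc (1 : ℝ≥0∞) = M ^ (v + v) * M⁻¹ ^ (v + v) := by
                  rw [← mul_pow, hMM, one_pow]
              _ ≤ M ^ ρ * M⁻¹ ^ (v + v) := by gcongr
              _ = _ := by rw [pow_add, mul_pow (M⁻¹)]
          · exact zero_le
      _ = (q false * M + q true * M⁻¹) ^ ρ := by
          rw [expect_const_mul, expect_pow_yesCount, ← mul_pow]
          congr 1
          calc M * (q true * (M⁻¹ * M⁻¹) + q false) = q true * M⁻¹ * (M * M⁻¹) + q false * M := by ring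
            _ = _ := by rw [hMM, mul_one, add_comm]
      _ ≤ _ := le_rfl

/-- Majority votes over a constant number of answers per binary digit of the desired accuracy. -/
theorem exists_votes {c : ℝ} (hc : c < 1 / 2) : ∃ A : ℕ, ∀ (q : PMF Bool) (a : Bool),
    q (!a) ≤ ENNReal.ofReal c → ∀ h, majority q (A * h) (!a) ≤ 2⁻¹ ^ h := by
  -- The floor `1/4` keeps `b` positive even if `c ≤ 0`. With `μ = 1 / (2b)` the base is `1/2 + 2b(1
  -- - b) = 1 - 2(b - 1/2)²`, which is below `1`.
  set b := max c (1 / 4) with hb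
  have hb4 : 1 / 4 ≤ b := le_max_right _ _
  have hb2 : b < 1 / 2 := max_lt hc (by norm_num)
  have hμ : 1 ≤ (2 * b)⁻¹ := (one_le_inv₀ (by linarith)).2 (by linarith)
  have hθ : b * (2 * b)⁻¹ + (1 - b) * ((2 * b)⁻¹)⁻¹ = 1 / 2 + 2 * b * (1 - b) := by
    have : b ≠ 0 := by linarith
    field_simp
  obtain ⟨A, hA⟩ := exists_pow_lt_of_lt_one (show (0 : ℝ) < 1 / 2 by norm_num)
    (show 1 / 2 + 2 * b * (1 - b) < 1 by nlinarith [sq_nonneg (b - 1 / 2)])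
  refine ⟨A, fun q a h j => ?_⟩
  refine (majority_error_le hμ (by linarith)
    (h.trans (ENNReal.ofReal_le_ofReal (le_max_left _ _))) _).trans ?_
  rw [hθ, pow_mul]
  refine pow_le_pow_left' ?_ j
  rw [← ENNReal.ofReal_pow (by nlinarith)]
  calc ENNReal.ofReal ((1 / 2 + 2 * b * (1 - b)) ^ A) ≤ ENNReal.ofReal 2⁻¹ :=
        ENNReal.ofReal_le_ofReal (by simpa using hA.le)
    _ = 2⁻¹ := by
        rw [ENNReal.ofReal_inv_of_pos (by norm_num)]
        simp

/-! ### The expected work -/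

section analysis

variable {I : Instance} {ora : Finset (Fin I.n) → PMF Bool} {ρ : ℕ} {δ : ℝ≥0∞}

theorem expect_work_repeated {n : ℕ} (A : PMF (Outcome n)) (j : ℕ) :
    (expect (repeated A j) fun r => (r.2 : ℝ≥0∞)) = j * expect A fun r => (r.2 : ℝ≥0∞) := by
  induction j with
  | zero => simp [repeated]
  | succ j ih =>
    simp only [repeated, expect_bind, expect_map, Outcome.join, Nat.cast_add]
    simp only [expect_add, expect_const, ih]
    push_cast
    ring

/-- The witnesses contained in `X`. -/
def Instance.below (I : Instance) (X : Finset (Fin I.n)) : Finset (Finset (Fin I.n)) :=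
  I.witnesses.filter (· ⊆ X)

/-- By linearity, each witness contributes its survival probability. Thus `2 ^ k` trials preserve
the expected total, which is why this is the branching number. -/
theorem expect_card_below (X : Finset (Fin I.n)) :
    (expect (randomSubset I.n) fun F => ((I.below (thin X F)).card : ℝ≥0∞)) =
      2⁻¹ ^ I.k * (I.below X).card := by
  have h : ∀ F, ((I.below (thin X F)).card : ℝ≥0∞) =
      ∑ W ∈ I.below X, if W ⊆ thin X F then 1 else 0 := by
    intro F
    rw [Finset.sum_boole, Instance.below, Instance.below, Finset.filter_filter]
    congr 2
    refine Finset.filter_congr fun W _ => ⟨fun h => ⟨h.trans (thin_subset X F), h⟩, fun h => h.2⟩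
  simp only [h]
  rw [expect_finset_sum, Finset.sum_congr rfl (g := fun _ => (2⁻¹ : ℝ≥0∞) ^ I.k)]
  · simp [mul_comm]
  · intro W hW
    obtain ⟨hW, hWX⟩ := Finset.mem_filter.1 hW
    rw [expect_subset_thin hWX, I.card_eq W hW]

/-- The term linear in the number of witnesses is passed on unchanged by the `2 ^ k` trials and
gains one summand per level; the constant term is passed on only through wrong votes and therefore
contracts. -/
theorem expect_work_explore (hδ : ∀ X, majority (ora X) ρ (!I.answer X) ≤ δ)
    (hR : 2 ^ I.k * δ ≤ 2⁻¹) (d : ℕ) (X : Finset (Fin I.n)) :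
    (expect (explore ora (2 ^ I.k) ρ d X) fun r => (r.2 : ℝ≥0∞)) ≤
      4 * 2 ^ I.k * (1 + d * (I.below X).card) := by
  have hone : (1 : ℝ≥0∞) ≤ 2 ^ I.k := one_le_pow₀ (by norm_num)
  induction d generalizing X with
  | zero =>
    simp only [explore, expect_pure, Nat.cast_one, Nat.cast_zero, zero_mul, add_zero, mul_one]
    calc (1 : ℝ≥0∞) ≤ 4 * 1 := by norm_num
      _ ≤ 4 * 2 ^ I.k := by gcongr
  | succ d ih =>
    have htrial : (expect (trial ora ρ (explore ora (2 ^ I.k) ρ d) X) fun r => (r.2 : ℝ≥0∞)) ≤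
        1 + (δ * (4 * 2 ^ I.k) + 4 * 2 ^ I.k * (d + 1) * (2⁻¹ ^ I.k * (I.below X).card)) := by
      rw [← expect_card_below, ← expect_const_mul, ← expect_const (randomSubset I.n) (δ * _),
        ← expect_add, ← expect_const (randomSubset I.n) 1, ← expect_add, expect_const, trial,
        expect_bind]
      refine expect_mono fun F => ?_
      set X' := thin X F
      rw [expect_bind, expect_bool]
      simp only [if_true, Bool.false_eq_true, if_false, expect_pure, expect_map, Outcome.succ,
        Nat.cast_add, Nat.cast_one, expect_add, expect_const]
      have hsum : majority (ora X') ρ true + majority (ora X') ρ false = 1 :=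
        pmf_bool_add _ true
      have hle : majority (ora X') ρ true ≤ 1 := PMF.coe_le_one _ _
      rw [mul_add, mul_one, mul_one, add_assoc, hsum, add_comm]
      refine add_le_add le_rfl ?_
      refine (mul_le_mul_right (ih X') _).trans ?_
      -- Without a witness, a positive vote is an error of probability at most `δ`. With one, the
      -- constant `1` is absorbed by the number of witnesses, raising `d` to `d + 1`.
      by_cases hN : I.below X' = ∅
      · have hans : I.answer X' = false := by
          rw [Instance.answer, decide_eq_false_iff_not]
          rintro ⟨W, hW, hWX⟩
          have : W ∈ I.below X' := Finset.mem_filter.2 ⟨hW, hWX⟩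
          simp [hN] at this
        have := hδ X'
        rw [hans] at this
        simp only [hN, Finset.card_empty, Nat.cast_zero, mul_zero, add_zero, mul_one]
        exact mul_le_mul_left this _
      · have h1 : (1 : ℝ≥0∞) ≤ (I.below X').card := by
          exact_mod_cast Finset.card_pos.2 (Finset.nonempty_iff_ne_empty.2 hN)
        calc majority (ora X') ρ true * (4 * 2 ^ I.k * (1 + d * (I.below X').card))
            ≤ 1 * (4 * 2 ^ I.k * ((I.below X').card + d * (I.below X').card)) := by gcongr
          _ = 4 * 2 ^ I.k * (d + 1) * (I.below X').card := by ring
          _ ≤ _ := le_add_self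
    have hcancel : (2 : ℝ≥0∞) ^ I.k * 2⁻¹ ^ I.k = 1 := by
      rw [← mul_pow, ENNReal.mul_inv_cancel (by norm_num) (by norm_num), one_pow]
    simp only [explore, expect_map, Outcome.succ, Nat.cast_add, Nat.cast_one, expect_add,
      expect_const, expect_work_repeated, Nat.cast_pow, Nat.cast_ofNat]
    calc 2 ^ I.k * (expect (trial ora ρ (explore ora (2 ^ I.k) ρ d) X) fun r => (r.2 : ℝ≥0∞)) + 1
        ≤ 2 ^ I.k * (1 + (δ * (4 * 2 ^ I.k) +
            4 * 2 ^ I.k * (d + 1) * (2⁻¹ ^ I.k * (I.below X).card))) + 2 ^ I.k := by gcongr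
      -- This fixes the constant `4`: the node and its trials cost `2 * 2 ^ k`, and wrong votes cost
      -- at most half of `4 * 2 ^ k`.
      _ = 2 * 2 ^ I.k + (2 ^ I.k * δ) * (4 * 2 ^ I.k) +
            (2 ^ I.k * 2⁻¹ ^ I.k) * (4 * 2 ^ I.k * (d + 1) * (I.below X).card) := by ring
      _ ≤ 2 * 2 ^ I.k + 2⁻¹ * (4 * 2 ^ I.k) +
            1 * (4 * 2 ^ I.k * (d + 1) * (I.below X).card) := by gcongr; exact hcancel.le
      _ = 4 * 2 ^ I.k * (1 + (d + 1) * (I.below X).card) := by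
          have : (2⁻¹ : ℝ≥0∞) * (4 * 2 ^ I.k) = 2 * 2 ^ I.k := by
            rw [show (4 : ℝ≥0∞) = 2 * 2 by norm_num, mul_assoc, ← mul_assoc,
              ENNReal.inv_mul_cancel (by norm_num) (by norm_num), one_mul]
          rw [this]
          ring

/-! ### The probability of success -/

/-- The probability that the search with law `A` does not find `W`. -/
noncomputable def miss {n : ℕ} (W : Finset (Fin n)) (A : PMF (Outcome n)) : ℝ≥0∞ :=
  expect A fun r => if W ∈ r.1 then 0 else 1

theorem miss_le_one {n : ℕ} (W : Finset (Fin n)) (A : PMF (Outcome n)) : miss W A ≤ 1 := by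
  rw [← expect_const A 1]
  exact expect_mono fun r => by split_ifs <;> simp

theorem miss_repeated {n : ℕ} (W : Finset (Fin n)) (A : PMF (Outcome n)) (j : ℕ) :
    miss W (repeated A j) = miss W A ^ j := by
  induction j with
  | zero => simp [miss, repeated]
  | succ j ih =>
    have h : ∀ r r' : Outcome n, (if W ∈ (r.join r').1 then (0 : ℝ≥0∞) else 1) =
        (if W ∈ r.1 then 0 else 1) * if W ∈ r'.1 then 0 else 1 := by
      intro r r'
      by_cases h : W ∈ r.1 <;> by_cases h' : W ∈ r'.1 <;> simp [Outcome.join, h, h']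
    rw [pow_succ, mul_comm, ← ih]
    simp only [miss, repeated, expect_bind, expect_map, h, expect_const_mul, expect_mul_const]

theorem miss_map_succ {n : ℕ} (W : Finset (Fin n)) (A : PMF (Outcome n)) :
    miss W (A.map Outcome.succ) = miss W A := by
  rw [miss, expect_map]
  rfl

/-- Through `exp (-y) ≤ 1 / (1 + y)`, this is the recursion for survival in a critical branching
process: success `y / R` per trial gives at least `y / (1 + y)` overall, and `y ≤ 1 / (d + 1)` makes
that at least `y * (d + 1) / (d + 2)`. -/
theorem one_sub_div_pow_le {d R : ℕ} {y t : ℝ} (ht : 0 ≤ t) (hR : 0 < R) (hy : 0 ≤ y)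
    (hyd : y ≤ 1 / (d + 1)) (h : t ≤ 1 - y / R) : t ^ R ≤ 1 - y * ((d + 1) / (d + 2)) := by
  have hd : (0 : ℝ) < d + 1 := by positivity
  have hy1 : y ≤ 1 := hyd.trans (by rw [div_le_one hd]; linarith)
  have hR1 : (1 : ℝ) ≤ R := by exact_mod_cast hR
  calc t ^ R ≤ (1 - y / R) ^ R := by gcongr
    _ ≤ Real.exp (-y) := Real.one_sub_div_pow_le_exp_neg (hy1.trans hR1)
    _ ≤ 1 / (1 + y) := by
        rw [Real.exp_neg, ← one_div]
        exact one_div_le_one_div_of_le (by linarith) (by linarith [Real.add_one_le_exp y])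
    _ ≤ _ := by
        have hyd' : y * (d + 1) ≤ 1 := by rwa [le_div_iff₀ hd] at hyd
        rw [div_le_iff₀ (by linarith)]
        have : (1 - y * ((d + 1) / (d + 2))) * (1 + y) - 1 =
            y * (1 - y * (d + 1)) / (d + 2) := by
          field_simp
          ring
        have h2 : 0 ≤ y * (1 - y * (d + 1)) / (d + 2) := by
          apply div_nonneg (mul_nonneg hy (by linarith))
          positivity
        linarith

/-- The hypothesis on `next` is affine in the number of surplus elements, so it can be averaged over
the thinning. `W` survives with probability `2 ^ (-k)`, and together with a given surplus element
with half of that; this turns `2 ^ d` into `2 ^ (d + 1)`. -/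
theorem miss_trial_le {δ σ : ℝ} (hδ1 : δ ≤ 1) (hσ : 0 ≤ σ) {W X : Finset (Fin I.n)} {d : ℕ}
    (hWX : W ⊆ X) (hW : W.card = I.k)
    (hyes : ∀ X, W ⊆ X → 1 - δ ≤ (majority (ora X) ρ true).toReal)
    {next : Finset (Fin I.n) → PMF (Outcome I.n)}
    (hnext : ∀ X, W ⊆ X →
      (miss W (next X)).toReal ≤ 1 - σ * (1 - ((X \ W).card : ℝ) / 2 ^ d)) :
    (miss W (trial ora ρ next X)).toReal ≤
      1 - (1 - δ) * σ * (1 - ((X \ W).card : ℝ) / 2 ^ (d + 1)) / (2 ^ I.k : ℕ) := by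
  obtain ⟨x, hx⟩ : ∃ x, x = (1 - δ) * σ := ⟨_, rfl⟩
  rw [← hx]
  have hx0 : 0 ≤ x := hx ▸ mul_nonneg (by linarith) hσ
  -- A pointwise inequality in additive form, as subtraction of extended nonnegative reals
  -- truncates. The sum counts the surviving surplus elements when `W` survives.
  have key : ∀ F, ((majority (ora (thin X F)) ρ true * miss W (next (thin X F)) +
      majority (ora (thin X F)) ρ false) + ENNReal.ofReal x * if W ⊆ thin X F then 1 else 0) ≤
      1 + ENNReal.ofReal (x / 2 ^ d) *
        ∑ u ∈ X \ W, if insert u W ⊆ thin X F then 1 else 0 := by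
    intro F
    set X' := thin X F
    have hsum : majority (ora X') ρ true + majority (ora X') ρ false = 1 :=
      pmf_bool_add _ true
    by_cases hWF : W ⊆ X'
    · have hcard : (∑ u ∈ X \ W, if insert u W ⊆ X' then (1 : ℝ≥0∞) else 0) =
          (X' \ W).card := by
        rw [Finset.sum_boole]
        congr 2
        ext u
        simp only [Finset.mem_filter, Finset.mem_sdiff, Finset.insert_subset_iff]
        exact ⟨fun h => ⟨h.2.1, h.1.2⟩, fun h => ⟨⟨thin_subset X F h.1, h.2⟩, h.1, hWF⟩⟩
      rw [hcard, if_pos hWF, mul_one]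
      have ht : majority (ora X') ρ true ≠ ∞ := PMF.apply_ne_top _ _
      have hf : majority (ora X') ρ false ≠ ∞ := PMF.apply_ne_top _ _
      have hm : miss W (next X') ≠ ∞ := ((miss_le_one _ _).trans_lt ENNReal.one_lt_top).ne
      have hsumR : (majority (ora X') ρ true).toReal + (majority (ora X') ρ false).toReal = 1 := by
        rw [← ENNReal.toReal_add ht hf, hsum, ENNReal.toReal_one]
      have hm1 : (miss W (next X')).toReal ≤ 1 := by
        simpa using ENNReal.toReal_mono ENNReal.one_ne_top (miss_le_one W (next X'))
      have hyesF := hyes X' hWF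
      have hnextF := hnext X' hWF
      have e1 : majority (ora X') ρ true * miss W (next X') + majority (ora X') ρ false +
          ENNReal.ofReal x = ENNReal.ofReal ((majority (ora X') ρ true).toReal *
            (miss W (next X')).toReal + (majority (ora X') ρ false).toReal + x) := by
        rw [ENNReal.ofReal_add (by positivity) hx0, ENNReal.ofReal_add (by positivity)
          (by positivity), ENNReal.ofReal_mul (by positivity), ENNReal.ofReal_toReal ht,
          ENNReal.ofReal_toReal hf, ENNReal.ofReal_toReal hm]
      have e2 : 1 + ENNReal.ofReal (x / 2 ^ d) * ((X' \ W).card : ℝ≥0∞) =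
          ENNReal.ofReal (1 + x / 2 ^ d * (X' \ W).card) := by
        rw [ENNReal.ofReal_add (by positivity) (by positivity),
          ENNReal.ofReal_mul (by positivity), ENNReal.ofReal_natCast, ENNReal.ofReal_one]
      rw [e1, e2]
      refine ENNReal.ofReal_le_ofReal ?_
      set f := (miss W (next X')).toReal
      set p := (majority (ora X') ρ true).toReal
      have h1 : (1 - δ) * (σ * (1 - ((X' \ W).card : ℝ) / 2 ^ d)) ≤ (1 - δ) * (1 - f) :=
        mul_le_mul_of_nonneg_left (by linarith) (by linarith)
      have h2 : (1 - δ) * (1 - f) ≤ p * (1 - f) :=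
        mul_le_mul_of_nonneg_right hyesF (by linarith)
      have h3 : (1 - δ) * (σ * (1 - ((X' \ W).card : ℝ) / 2 ^ d)) =
          x - x / 2 ^ d * (X' \ W).card := by
        rw [hx]
        ring
      linarith
    · rw [if_neg hWF, mul_zero, add_zero]
      calc majority (ora X') ρ true * miss W (next X') + majority (ora X') ρ false
          ≤ majority (ora X') ρ true * 1 + majority (ora X') ρ false := by
            gcongr
            exact miss_le_one _ _
        _ = 1 := by rw [mul_one, hsum]
        _ ≤ _ := le_self_add
  have htrial : miss W (trial ora ρ next X) + ENNReal.ofReal x * 2⁻¹ ^ I.k ≤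
      1 + ENNReal.ofReal (x / 2 ^ d) * ((X \ W).card * 2⁻¹ ^ (I.k + 1)) := by
    have hexp := expect_mono (p := randomSubset I.n) key
    rw [expect_add, expect_const_mul, expect_subset_thin hWX, hW, expect_add, expect_add, expect_const,
      expect_const_mul, expect_finset_sum, Finset.sum_congr rfl
      (g := fun _ => (2⁻¹ : ℝ≥0∞) ^ (I.k + 1)), Finset.sum_const, nsmul_eq_mul] at hexp
    · have e : miss W (trial ora ρ next X) = expect (randomSubset I.n) fun F =>
          majority (ora (thin X F)) ρ true * miss W (next (thin X F)) +
            majority (ora (thin X F)) ρ false := by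
        rw [miss, trial, expect_bind]
        congr 1
        funext F
        rw [expect_bind, expect_bool]
        change majority (ora (thin X F)) ρ true * miss W ((next (thin X F)).map Outcome.succ) +
          majority (ora (thin X F)) ρ false * miss W (PMF.pure (∅, 1)) = _
        rw [miss_map_succ]
        simp [miss]
      rwa [e, expect_add]
    · intro u hu
      obtain ⟨huX, huW⟩ := Finset.mem_sdiff.1 hu
      rw [expect_subset_thin (Finset.insert_subset huX hWX), Finset.card_insert_of_notMem huW, hW]
  have hm : miss W (trial ora ρ next X) ≠ ∞ := ((miss_le_one _ _).trans_lt ENNReal.one_lt_top).ne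
  have hreal := ENNReal.toReal_mono (by finiteness) htrial
  rw [ENNReal.toReal_add hm (by finiteness), ENNReal.toReal_add (by finiteness) (by finiteness)]
    at hreal
  simp only [ENNReal.toReal_mul, ENNReal.toReal_ofReal hx0,
    ENNReal.toReal_ofReal (show 0 ≤ x / 2 ^ d by positivity), ENNReal.toReal_pow,
    ENNReal.toReal_inv, ENNReal.toReal_ofNat, ENNReal.toReal_natCast, ENNReal.toReal_one] at hreal
  have e : x / 2 ^ d * ((X \ W).card * (2 : ℝ)⁻¹ ^ (I.k + 1)) - x * (2 : ℝ)⁻¹ ^ I.k =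
      - (x * (1 - ((X \ W).card : ℝ) / 2 ^ (d + 1)) / (2 ^ I.k : ℕ)) := by
    push_cast
    simp only [inv_pow, pow_succ]
    field_simp
    ring
  linarith

/-- The factors stand for correct votes, survival of a critical process, and loss of all surplus
elements. -/
theorem miss_explore_le {δ : ℝ} (hδ0 : 0 ≤ δ) (hδ1 : δ ≤ 1) {W : Finset (Fin I.n)}
    (hW : W.card = I.k) (hyes : ∀ X, W ⊆ X → 1 - δ ≤ (majority (ora X) ρ true).toReal)
    (d : ℕ) (X : Finset (Fin I.n)) (hWX : W ⊆ X) :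
    (miss W (explore ora (2 ^ I.k) ρ d X)).toReal ≤
      1 - (1 - δ) ^ d / (d + 1) * (1 - ((X \ W).card : ℝ) / 2 ^ d) := by
  induction d generalizing X with
  | zero =>
    -- At height zero the set itself is the outcome. If `X ≠ W`, a surplus element makes the claimed
    -- bound at least `1`.
    by_cases h : W = X
    · simp [explore, miss, h]
    · have hpos : (1 : ℝ) ≤ (X \ W).card := by
        have : (X \ W).Nonempty := by
          rw [Finset.sdiff_nonempty]
          exact fun h' => h (hWX.antisymm h')
        exact_mod_cast Finset.card_pos.2 this
      have := ENNReal.toReal_mono ENNReal.one_ne_top (miss_le_one W (explore ora (2 ^ I.k) ρ 0 X))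
      simp only [ENNReal.toReal_one] at this
      simp
      linarith
  | succ d ih =>
    have h := miss_trial_le hδ1 (σ := (1 - δ) ^ d / (d + 1))
      (div_nonneg (pow_nonneg (by linarith) _) (by positivity)) hWX hW hyes ih
    have hle : (miss W (explore ora (2 ^ I.k) ρ (d + 1) X)).toReal ≤ 1 := by
      simpa using ENNReal.toReal_mono ENNReal.one_ne_top (miss_le_one W (explore ora (2 ^ I.k) ρ (d + 1) X))
    set z := 1 - ((X \ W).card : ℝ) / 2 ^ (d + 1) with hz
    have hz1 : z ≤ 1 := by
      have : (0 : ℝ) ≤ ((X \ W).card : ℝ) / 2 ^ (d + 1) := by positivity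
      linarith
    have hpow : 0 ≤ (1 - δ) ^ (d + 1) := pow_nonneg (by linarith) _
    have hpow1 : (1 - δ) ^ (d + 1) ≤ 1 := pow_le_one₀ (by linarith) (by linarith)
    -- With too many surplus elements the bound is at least `1` and holds trivially.
    by_cases hz0 : z ≤ 0
    · refine hle.trans ?_
      have : (1 - δ) ^ (d + 1) / ((d + 1 : ℕ) + 1) * z ≤ 0 :=
        mul_nonpos_of_nonneg_of_nonpos (div_nonneg hpow (by positivity)) hz0
      linarith
    · push Not at hz0
      rw [explore, miss_map_succ, miss_repeated, ENNReal.toReal_pow]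
      have hy : (1 - δ) * ((1 - δ) ^ d / (d + 1)) * z = (1 - δ) ^ (d + 1) / (d + 1) * z := by
        ring
      rw [hy] at h
      refine (one_sub_div_pow_le (d := d) ENNReal.toReal_nonneg (by positivity)
        (mul_nonneg (div_nonneg hpow (by positivity)) hz0.le) ?_ h).trans (le_of_eq ?_)
      · calc (1 - δ) ^ (d + 1) / (d + 1) * z ≤ 1 / (d + 1) * 1 := by gcongr
          _ = _ := mul_one _
      · push_cast
        field_simp
        ring

end analysis

/-! ### The properties of the algorithm -/

section final

variable {I : Instance} {ora : Finset (Fin I.n) → PMF Bool} {τ : ℕ} {ε : ℝ}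

theorem expect_run_le_limExpect (P : Cmd) (t : ℕ) (f : Config I.n → ℝ≥0∞) :
    expect (run P I ora τ ε t) f ≤
      limExpect I ora τ f ([P], initState I.n I.k ⌈1 / ε⌉₊) := by
  rw [expect_run]
  exact le_iSup (fun t => afterSteps I ora τ f t ([P], initState I.n I.k ⌈1 / ε⌉₊)) t

theorem limExpect_eq_iSup (P : Cmd) (f : Config I.n → ℝ≥0∞) :
    limExpect I ora τ f ([P], initState I.n I.k ⌈1 / ε⌉₊) =
      ⨆ t, expect (run P I ora τ ε t) f := by
  simp only [expect_run, limExpect]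

/-- The indicator of a wrong output never decreases along a run, and its limiting expectation is
zero by the final table; hence it vanishes almost surely at every finite time. -/
theorem outputsOnlyWitnesses_main (A : ℕ) : OutputsOnlyWitnesses (Prog.main A) I ora τ ε := by
  classical
  set f : Config I.n → ℝ≥0∞ := fun x => if ∀ X ∈ x.2.out, X ∈ I.witnesses then 0 else 1 with hf
  have hmono : ∀ x, f x ≤ expect (step I ora τ x) f := by
    refine fun x => le_expect_step fun y hy => ?_
    have h := (step_support hy).2.2.1
    by_cases hy' : ∀ X ∈ y.2.out, X ∈ I.witnesses
    · have hx' : ∀ X ∈ x.2.out, X ∈ I.witnesses := fun X hX => hy' X (h hX)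
      simp only [hf, if_pos hx', if_pos hy', le_refl]
    · simp only [hf, if_neg hy']
      split_ifs <;> simp
  have hzero : limExpect I ora τ f ([Prog.main A], initState I.n I.k ⌈1 / ε⌉₊) ≤ 0 := by
    have h := (reaches_main (ora := ora) (τ := τ) A ⌈1 / ε⌉₊ _ (harmonic_limExpect hmono)
      fun _ => 0).1
    rw [expect_const] at h
    refine h ?_
    rintro r y ⟨s', rfl, hT, -⟩
    rw [limExpect_halted]
    simp only [hf]
    rw [if_pos hT.witness]
  intro t x hx X hX
  have h0 : expect (run (Prog.main A) I ora τ ε t) f = 0 :=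
    le_antisymm ((expect_run_le_limExpect _ _ _).trans hzero) zero_le
  rw [expect, ENNReal.tsum_eq_zero] at h0
  have := (mul_eq_zero.1 (h0 x)).resolve_left ((PMF.mem_support_iff _ _).1 hx)
  by_contra hXW
  have hneg : ¬ ∀ X ∈ x.2.out, X ∈ I.witnesses := fun h => hXW (h X hX)
  simp [hf, if_neg hneg] at this

theorem expectedCalls_main_le (A : ℕ) : expectedCalls (Prog.main A) I ora τ ε ≤
    (numVotes A I.n I.k + 1 : ℕ) *
      expect (enumeration A I.k ⌈1 / ε⌉₊ ora) fun r => (r.2 : ℝ≥0∞) := by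
  have hmono : ∀ x : Config I.n, (x.2.calls : ℝ≥0∞) ≤
      expect (step I ora τ x) fun x => (x.2.calls : ℝ≥0∞) :=
    fun x => le_expect_step (f := fun x => (x.2.calls : ℝ≥0∞))
      fun y hy => Nat.cast_le.2 (step_support hy).1
  have e : expectedCalls (Prog.main A) I ora τ ε = limExpect I ora τ
      (fun x => (x.2.calls : ℝ≥0∞)) ([Prog.main A], initState I.n I.k ⌈1 / ε⌉₊) :=
    (limExpect_eq_iSup _ _).symm
  rw [e, ← expect_const_mul]
  refine (reaches_main A ⌈1 / ε⌉₊ _ (harmonic_limExpect hmono) _).1 ?_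
  rintro r y ⟨s', rfl, -, hc, -⟩
  rw [limExpect_halted]
  exact_mod_cast hc

theorem expectedTime_main_le (A : ℕ) : expectedTime (Prog.main A) I ora τ ε ≤
    (unitTime I.n (numVotes A I.n I.k) τ : ℕ) *
      (expect (enumeration A I.k ⌈1 / ε⌉₊ ora) fun r => (r.2 : ℝ≥0∞)) +
      (52 * (I.n + 1) * numRounds I.n ⌈1 / ε⌉₊ +
        100 * (I.n + I.k + numLevels I.n + Nat.size ⌈1 / ε⌉₊ + 1) : ℕ) := by
  have hmono : ∀ x : Config I.n, (x.2.time : ℝ≥0∞) ≤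
      expect (step I ora τ x) fun x => (x.2.time : ℝ≥0∞) :=
    fun x => le_expect_step (f := fun x => (x.2.time : ℝ≥0∞))
      fun y hy => Nat.cast_le.2 (step_support hy).2.1
  have e : expectedTime (Prog.main A) I ora τ ε = limExpect I ora τ
      (fun x => (x.2.time : ℝ≥0∞)) ([Prog.main A], initState I.n I.k ⌈1 / ε⌉₊) :=
    (limExpect_eq_iSup _ _).symm
  rw [e, ← expect_const_mul, ← expect_const (enumeration A I.k ⌈1 / ε⌉₊ ora)
    ((52 * (I.n + 1) * numRounds I.n ⌈1 / ε⌉₊ +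
        100 * (I.n + I.k + numLevels I.n + Nat.size ⌈1 / ε⌉₊ + 1) : ℕ) : ℝ≥0∞), ← expect_add]
  refine (reaches_main A ⌈1 / ε⌉₊ _ (harmonic_limExpect hmono) _).1 ?_
  rintro r y ⟨s', rfl, -, -, ht⟩
  rw [limExpect_halted, ← Nat.cast_mul, ← Nat.cast_add]
  refine Nat.cast_le.2 (ht.trans ?_)
  rw [add_assoc]

theorem probListedOnce_main_ge (A : ℕ) {W : Finset (Fin I.n)} (hW : W ∈ I.witnesses) :
    (expect (enumeration A I.k ⌈1 / ε⌉₊ ora) fun r => if W ∈ r.1 then 1 else 0) ≤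
      probListedOnce (Prog.main A) I ora τ ε W := by
  classical
  set S : Set (Config I.n) := {x | x.1 = [] ∧ x.2.out.count W = 1} with hS
  have hmono : ∀ x : Config I.n, S.indicator (fun _ => (1 : ℝ≥0∞)) x ≤
      expect (step I ora τ x) (S.indicator fun _ => (1 : ℝ≥0∞)) := by
    refine fun x => le_expect_step fun y hy => ?_
    by_cases hx : x ∈ S
    · rw [(step_support hy).2.2.2 hx.1]
    · simp [Set.indicator_of_notMem hx]
  have e : probListedOnce (Prog.main A) I ora τ ε W = limExpect I ora τ
      (S.indicator fun _ => (1 : ℝ≥0∞)) ([Prog.main A], initState I.n I.k ⌈1 / ε⌉₊) := by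
    rw [limExpect_eq_iSup]
    refine iSup_congr fun t => ?_
    rw [PMF.toOuterMeasure_apply, expect]
    refine tsum_congr fun x => ?_
    by_cases hx : x ∈ S
    · rw [Set.indicator_of_mem hx, Set.indicator_of_mem hx, mul_one]
    · rw [Set.indicator_of_notMem hx, Set.indicator_of_notMem hx, mul_zero]
  rw [e]
  refine (reaches_main A ⌈1 / ε⌉₊ _ (harmonic_limExpect hmono) _).2 ?_
  rintro r y ⟨s', rfl, hT, -⟩
  rw [limExpect_halted]
  have hcount := hT.count W hW
  split_ifs with h
  · rw [if_pos h] at hcount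
    rw [Set.indicator_of_mem (show (([], s') : Config I.n) ∈ S from ⟨rfl, hcount⟩)]
  · exact zero_le

theorem two_mul_lt_two_pow_numLevels (n : ℕ) : 2 * n < 2 ^ numLevels n := by
  have := Nat.lt_size_self n
  rw [numLevels, pow_add]
  omega

theorem expect_work_enumeration {A : ℕ}
    (hA : ∀ X h, majority (ora X) (A * h) (!I.answer X) ≤ 2⁻¹ ^ h)
    (m : ℕ) : (expect (enumeration A I.k m ora) fun r => (r.2 : ℝ≥0∞)) ≤
      (numRounds I.n m * (4 * 2 ^ I.k * (1 + numLevels I.n * I.witnesses.card)) : ℕ) := by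
  rw [enumeration, expect_work_repeated]
  push_cast
  refine mul_le_mul_right ?_ _
  have hbelow : I.below Finset.univ = I.witnesses := by simp [Instance.below]
  rw [← hbelow]
  refine expect_work_explore (fun X => hA X (I.k + (numLevels I.n + 1))) ?_ _ _
  -- The `k` in the vote length cancels the branching, and the `+ 1` provides the required half.
  calc (2 : ℝ≥0∞) ^ I.k * 2⁻¹ ^ (I.k + (numLevels I.n + 1))
      = (2 * 2⁻¹) ^ I.k * (2⁻¹ ^ numLevels I.n * 2⁻¹) := by
        rw [pow_add, pow_succ, mul_pow]
        ring
    _ ≤ 1 * (1 * 2⁻¹) := by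
        gcongr
        · rw [ENNReal.mul_inv_cancel (by norm_num) (by norm_num), one_pow]
        · exact pow_le_one₀ zero_le (by simp)
    _ = _ := by simp

/-- The votes along a branch and the surplus elements cost a factor `1/2` each, and survival costs
`1 / (D + 1)`. -/
theorem miss_round_le {A : ℕ} (hA : ∀ X h, majority (ora X) (A * h) (!I.answer X) ≤ 2⁻¹ ^ h)
    {W : Finset (Fin I.n)} (hW : W ∈ I.witnesses) :
    (miss W (explore ora (2 ^ I.k) (numVotes A I.n I.k) (numLevels I.n) Finset.univ)).toReal ≤
      1 - 1 / (4 * (numLevels I.n + 1) : ℕ) := by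
  set D := numLevels I.n with hD
  set δ : ℝ := 2⁻¹ ^ (I.k + (D + 1)) with hδ
  have hδ0 : 0 ≤ δ := by positivity
  have hδ1 : δ ≤ 1 := pow_le_one₀ (by norm_num) (by norm_num)
  have hyes : ∀ X, W ⊆ X → 1 - δ ≤ (majority (ora X) (numVotes A I.n I.k) true).toReal := by
    intro X hX
    have hans : I.answer X = true := decide_eq_true ⟨W, hW, hX⟩
    have h := hA X (I.k + (D + 1))
    rw [hans] at h
    have hsum := congrArg ENNReal.toReal (pmf_bool_add (majority (ora X) (numVotes A I.n I.k)) true)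
    rw [ENNReal.toReal_add (PMF.apply_ne_top _ _) (PMF.apply_ne_top _ _), ENNReal.toReal_one]
      at hsum
    have hle := ENNReal.toReal_mono (by finiteness) h
    rw [ENNReal.toReal_pow, ENNReal.toReal_inv, ENNReal.toReal_ofNat] at hle
    change (majority (ora X) (numVotes A I.n I.k) (!true)).toReal ≤ δ at hle
    linarith
  refine (miss_explore_le hδ0 hδ1 (I.card_eq W hW) hyes D _ (Finset.subset_univ W)).trans ?_
  -- Bernoulli's inequality, with `D * δ ≤ 2 ^ D * 2 ^ (-(D + 1))`.
  have hpow : 1 / 2 ≤ (1 - δ) ^ D := by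
    have h1 : D * δ ≤ 1 / 2 := by
      have h2 : δ ≤ 2⁻¹ ^ (D + 1) :=
        pow_le_pow_of_le_one (by norm_num) (by norm_num) (by omega)
      have h3 : (D : ℝ) ≤ 2 ^ D := by exact_mod_cast (Nat.lt_two_pow_self (n := D)).le
      calc D * δ ≤ 2 ^ D * 2⁻¹ ^ (D + 1) := by gcongr
        _ = 1 / 2 := by
          rw [pow_succ, ← mul_assoc, ← mul_pow]
          norm_num
    have := one_add_mul_le_pow (a := -δ) (by linarith) D
    calc 1 / 2 ≤ 1 + D * -δ := by linarith
      _ ≤ (1 + -δ) ^ D := this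
      _ = _ := by ring
  have hcard : 1 / 2 ≤ 1 - ((Finset.univ \ W).card : ℝ) / 2 ^ D := by
    have h1 : ((Finset.univ \ W).card : ℝ) ≤ I.n := by
      have := Finset.card_le_univ (Finset.univ \ W)
      rw [Fintype.card_fin] at this
      exact_mod_cast this
    have h2 : (2 * I.n : ℝ) ≤ 2 ^ D := by
      exact_mod_cast (two_mul_lt_two_pow_numLevels I.n).le
    have h3 : ((Finset.univ \ W).card : ℝ) / 2 ^ D ≤ 1 / 2 := by
      rw [div_le_iff₀ (by positivity)]
      linarith
    linarith
  have hmul : 1 / (4 * (D + 1) : ℕ) ≤ (1 - δ) ^ D / (D + 1) *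
      (1 - ((Finset.univ \ W).card : ℝ) / 2 ^ D) := by
    calc (1 : ℝ) / (4 * (D + 1) : ℕ) = 1 / 2 / (D + 1) * (1 / 2) := by
          push_cast
          field_simp
          norm_num
      _ ≤ _ := by gcongr
  linarith

/-- A block of `q` rounds fails with probability at most `1 / e ≤ 1/2`, and `Nat.size m` blocks give
`2 ^ (-size m) ≤ 1 / m ≤ ε`. -/
theorem miss_enumeration_le {A : ℕ} (hA : ∀ X h, majority (ora X) (A * h) (!I.answer X) ≤ 2⁻¹ ^ h)
    (hε : 0 < ε) {W : Finset (Fin I.n)} (hW : W ∈ I.witnesses) :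
    miss W (enumeration A I.k ⌈1 / ε⌉₊ ora) ≤ ENNReal.ofReal ε := by
  set m := ⌈1 / ε⌉₊ with hm
  have hround := miss_round_le hA hW
  rw [enumeration, miss_repeated, numRounds, pow_mul]
  set A' := explore ora (2 ^ I.k) (numVotes A I.n I.k) (numLevels I.n) Finset.univ
  set q := 4 * (numLevels I.n + 1) with hq
  have hfin : miss W A' ≠ ∞ := ((miss_le_one _ _).trans_lt ENNReal.one_lt_top).ne
  rw [ENNReal.le_ofReal_iff_toReal_le (by finiteness) hε.le, ENNReal.toReal_pow,
    ENNReal.toReal_pow]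
  have hq1 : (1 : ℝ) ≤ q := by
    have : 1 ≤ q := by omega
    exact_mod_cast this
  have h1 : (miss W A').toReal ^ q ≤ 1 / 2 := by
    calc (miss W A').toReal ^ q ≤ (1 - 1 / q) ^ q :=
          pow_le_pow_left₀ ENNReal.toReal_nonneg hround _
      _ ≤ Real.exp (-1) := Real.one_sub_div_pow_le_exp_neg hq1
      _ ≤ 1 / 2 := by
          rw [Real.exp_neg, ← one_div]
          exact one_div_le_one_div_of_le (by norm_num) (by linarith [Real.add_one_le_exp 1])
  have hmε : 1 / ε ≤ m := Nat.le_ceil _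
  have hm2 : (m : ℝ) ≤ 2 ^ Nat.size m := by exact_mod_cast (Nat.lt_size_self m).le
  calc ((miss W A').toReal ^ q) ^ Nat.size m ≤ (1 / 2) ^ Nat.size m := by
        gcongr
    _ = 1 / 2 ^ Nat.size m := by rw [div_pow, one_pow]
    _ ≤ 1 / (1 / ε) := one_div_le_one_div_of_le (by positivity) (hmε.trans hm2)
    _ = ε := one_div_one_div ε

theorem le_probListedOnce_main {A : ℕ}
    (hA : ∀ X h, majority (ora X) (A * h) (!I.answer X) ≤ 2⁻¹ ^ h)
    (hε : 0 < ε) {W : Finset (Fin I.n)} (hW : W ∈ I.witnesses) :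
    ENNReal.ofReal (1 - ε) ≤ probListedOnce (Prog.main A) I ora τ ε W := by
  refine le_trans ?_ (probListedOnce_main_ge A hW)
  rw [ENNReal.ofReal_sub _ hε.le, ENNReal.ofReal_one, tsub_le_iff_right]
  refine le_trans ?_ (add_le_add_right (miss_enumeration_le hA hε hW) _)
  rw [miss, ← expect_add]
  refine le_of_eq ?_
  rw [← expect_const (enumeration A I.k ⌈1 / ε⌉₊ ora) 1]
  congr 1
  funext r
  split_ifs <;> simp

/-! ### Numerical bounds -/

/-- The leading binary digit gives `2 ^ (size n - 1) ≤ n` for `n > 0`; the extra summand `log 2`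
also covers `n = 0`. -/
theorem size_mul_log_two_le {n : ℕ} {y : ℝ} (hy : 1 ≤ y) (hn : (n : ℝ) ≤ y) :
    Nat.size n * Real.log 2 ≤ Real.log 2 + Real.log y := by
  have h : (2 : ℝ) ^ Nat.size n ≤ 2 * y := by
    rcases Nat.eq_zero_or_pos (Nat.size n) with h0 | h0
    · rw [h0]
      linarith
    · obtain ⟨j, hj⟩ := Nat.exists_eq_succ_of_ne_zero h0.ne'
      have h1 : 2 ^ j ≤ n := Nat.lt_size.1 (by omega)
      have h2 : (2 : ℝ) ^ j ≤ n := by exact_mod_cast h1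
      rw [hj, pow_succ]
      linarith
  rw [← Real.log_pow, ← Real.log_mul (by norm_num) (by linarith)]
  exact Real.log_le_log (by positivity) h

theorem numLevels_le_log (n : ℕ) : (numLevels n : ℝ) ≤ 5 * Real.log (n + 2) := by
  have h := size_mul_log_two_le (n := n) (y := n + 2) (by linarith [n.cast_nonneg (α := ℝ)])
    (by linarith)
  have h2 := Real.log_two_gt_d9
  have h3 : Real.log 2 ≤ Real.log (n + 2) :=
    Real.log_le_log (by norm_num) (by linarith [n.cast_nonneg (α := ℝ)])
  have h4 : (0 : ℝ) ≤ Nat.size n := Nat.cast_nonneg _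
  rw [numLevels]
  push_cast
  -- The previous facts give `numLevels n * log 2 ≤ 3 * log (n + 2)`, and `3 / log 2 < 5`.
  nlinarith

theorem numLevels_le (n : ℕ) : numLevels n ≤ n + 1 := by
  have : Nat.size n ≤ n := Nat.size_le.2 Nat.lt_two_pow_self
  rw [numLevels]
  omega

theorem size_ceil_le (hε : 0 < ε) :
    (Nat.size ⌈1 / ε⌉₊ : ℝ) ≤ 2 * (1 + Real.log (1 + 1 / ε)) := by
  have hpos : 0 < 1 / ε := by positivity
  have h := size_mul_log_two_le (n := ⌈1 / ε⌉₊) (y := 1 + 1 / ε) (by linarith)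
    (by linarith [Nat.ceil_lt_add_one hpos.le])
  have h2 := Real.log_two_gt_d9
  have h2' := Real.log_two_lt_d9
  have h3 : 0 ≤ Real.log (1 + 1 / ε) := Real.log_nonneg (by linarith)
  have h4 : (0 : ℝ) ≤ Nat.size ⌈1 / ε⌉₊ := Nat.cast_nonneg _
  nlinarith

theorem numVotes_succ_le {A k D : ℕ} (hD : 1 ≤ D) :
    A * (k + (D + 1)) + 1 ≤ 3 * (A + 1) * (2 ^ k * D) := by
  have h1 : k + 1 ≤ 2 ^ k := Nat.lt_two_pow_self
  have h2 : k + (D + 1) ≤ 3 * (2 ^ k * D) := by nlinarith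
  have h3 : 1 ≤ 3 * (2 ^ k * D) := by omega
  calc A * (k + (D + 1)) + 1 ≤ A * (3 * (2 ^ k * D)) + 3 * (2 ^ k * D) := by gcongr
    _ = _ := by ring

theorem work_le {D L k N : ℕ} (hD : 1 ≤ D) :
    4 * (D + 1) * L * (4 * 2 ^ k * (1 + D * N)) ≤ 64 * (D ^ 2 * L * 2 ^ k * max 1 N) := by
  have h1 : D + 1 ≤ 2 * D := by omega
  have h2 : 1 + D * N ≤ 2 * (D * max 1 N) := by
    have h3 : 1 ≤ max 1 N := le_max_left _ _
    have h4 : N ≤ max 1 N := le_max_right _ _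
    nlinarith
  calc 4 * (D + 1) * L * (4 * 2 ^ k * (1 + D * N))
      ≤ 4 * (2 * D) * L * (4 * 2 ^ k * (2 * (D * max 1 N))) := by gcongr
    _ = _ := by ring

/-- The three logarithms come from the length of a vote, the number of rounds, and the number of
levels. -/
theorem calls_bound (A n k N : ℕ) {ε : ℝ} (hε : 0 < ε) :
    (((numVotes A n k + 1) * (numRounds n ⌈1 / ε⌉₊ *
      (4 * 2 ^ k * (1 + numLevels n * N))) : ℕ) : ℝ) ≤
      (48000 * (A + 1) : ℕ) * 2 ^ (48000 * (A + 1) * k) * Real.log (n + 2) ^ 3 * max 1 (N : ℝ) *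
        (1 + Real.log (1 + 1 / ε)) ^ (48000 * (A + 1)) := by
  have hD : 1 ≤ numLevels n := by rw [numLevels]; omega
  have hDl := numLevels_le_log n
  have hL := size_ceil_le hε
  have hE1 : 1 ≤ 1 + Real.log (1 + 1 / ε) := by
    have : 0 ≤ Real.log (1 + 1 / ε) := Real.log_nonneg (by linarith [one_div_pos.2 hε])
    linarith
  have hnat := Nat.mul_le_mul (numVotes_succ_le (A := A) (k := k) hD)
    (work_le (L := Nat.size ⌈1 / ε⌉₊) (k := k) (N := N) hD)
  rw [← numVotes, ← numRounds] at hnat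
  set E := 1 + Real.log (1 + 1 / ε)
  set D := numLevels n
  set L := Nat.size ⌈1 / ε⌉₊
  set l := Real.log (n + 2)
  set C := 48000 * (A + 1) with hC
  have hN : (0 : ℝ) ≤ max 1 (N : ℝ) := le_trans zero_le_one (le_max_left _ _)
  have hl : 0 ≤ l := by
    have : (0 : ℝ) ≤ D := Nat.cast_nonneg _
    linarith
  calc (((numVotes A n k + 1) * (numRounds n ⌈1 / ε⌉₊ * (4 * 2 ^ k * (1 + D * N))) : ℕ) : ℝ)
      ≤ ((3 * (A + 1) * (2 ^ k * D) * (64 * (D ^ 2 * L * 2 ^ k * max 1 N)) : ℕ) : ℝ) :=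
        Nat.cast_le.2 hnat
    _ = 192 * (A + 1) * 2 ^ (2 * k) * (D : ℝ) ^ 3 * max 1 (N : ℝ) * L := by
        push_cast
        ring
    _ ≤ 192 * (A + 1) * 2 ^ (2 * k) * (5 * l) ^ 3 * max 1 (N : ℝ) * (2 * E) := by gcongr
    -- The constant is `192 * 5 ^ 3 * 2 = 48000`.
    _ = C * 2 ^ (2 * k) * l ^ 3 * max 1 (N : ℝ) * E := by
        rw [hC]
        push_cast
        ring
    _ ≤ C * 2 ^ (C * k) * l ^ 3 * max 1 (N : ℝ) * E ^ C := by
        gcongr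
        · norm_num
        · omega
        · exact le_self_pow₀ hE1 (by omega)

theorem time_bound (A a n k N g τ : ℕ) (hg : 1 ≤ g) (hτ : τ ≤ g * n ^ a) {ε : ℝ} (hε : 0 < ε) :
    ((unitTime n (numVotes A n k) τ * (numRounds n ⌈1 / ε⌉₊ *
      (4 * 2 ^ k * (1 + numLevels n * N))) + (52 * (n + 1) * numRounds n ⌈1 / ε⌉₊ +
        100 * (n + k + numLevels n + Nat.size ⌈1 / ε⌉₊ + 1)) : ℕ) : ℝ) ≤
      (40000 * (A + 1) + a + 4 : ℕ) * 2 ^ ((40000 * (A + 1) + a + 4) * k) * g *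
        (n + 1) ^ (40000 * (A + 1) + a + 4) * max 1 (N : ℝ) *
        (1 + Real.log (1 + 1 / ε)) ^ (40000 * (A + 1) + a + 4) := by
  have hD : 1 ≤ numLevels n := by rw [numLevels]; omega
  have hDn := numLevels_le n
  have hL := size_ceil_le hε
  have hL1 : 1 ≤ Nat.size ⌈1 / ε⌉₊ :=
    Nat.size_pos.2 (Nat.ceil_pos.2 (by positivity))
  have hE1 : 1 ≤ 1 + Real.log (1 + 1 / ε) := by
    have : 0 ≤ Real.log (1 + 1 / ε) := Real.log_nonneg (by linarith [one_div_pos.2 hε])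
    linarith
  have hwork := work_le (L := Nat.size ⌈1 / ε⌉₊) (k := k) (N := N) hD
  have hvotes := numVotes_succ_le (A := A) (k := k) hD
  rw [← numVotes] at hvotes
  rw [← numRounds] at hwork
  have hrounds : numRounds n ⌈1 / ε⌉₊ ≤ 8 * ((n + 1) * Nat.size ⌈1 / ε⌉₊) := by
    rw [numRounds]
    calc 4 * (numLevels n + 1) * Nat.size ⌈1 / ε⌉₊
        ≤ 4 * (2 * (n + 1)) * Nat.size ⌈1 / ε⌉₊ := by gcongr; omega
      _ = _ := by ring
  set E := 1 + Real.log (1 + 1 / ε)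
  set D := numLevels n
  set L := Nat.size ⌈1 / ε⌉₊
  set C := 40000 * (A + 1) + a + 4 with hC
  set M := numRounds n ⌈1 / ε⌉₊
  set ν := n + 1 with hν
  have hν1 : 1 ≤ ν := by omega
  have hK : k + 1 ≤ 2 ^ k := Nat.lt_two_pow_self
  have hN1 : 1 ≤ max 1 N := le_max_left _ _
  have hτ' : τ ≤ g * ν ^ a := hτ.trans (by gcongr; omega)
  have hcall : n + τ + 18 ≤ 19 * (g * ν ^ (a + 1)) := by
    have h1 : n + 18 ≤ 18 * ν := by omega
    have h2 : 18 * ν ≤ 18 * (g * ν ^ (a + 1)) := by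
      have : ν ^ 1 ≤ ν ^ (a + 1) := Nat.pow_le_pow_right hν1 (by omega)
      nlinarith
    have h3 : g * ν ^ a ≤ g * ν ^ (a + 1) := by gcongr; omega
    omega
  have hunit : unitTime n (numVotes A n k) τ ≤ 257 * ((A + 1) * 2 ^ k * g * ν ^ (a + 2)) := by
    have h1 : ν ≤ (A + 1) * 2 ^ k * g * ν ^ (a + 2) := by
      calc ν = 1 * 1 * 1 * ν ^ 1 := by ring
        _ ≤ _ := by
          gcongr
          · omega
          · exact Nat.one_le_two_pow
          · omega
    -- Here `57 = 3 * 19`; the traversal term `200` of `unitTime` then gives `257`.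
    have h2 : (numVotes A n k + 1) * (n + τ + 18) ≤ 57 * ((A + 1) * 2 ^ k * g * ν ^ (a + 2)) := by
      calc (numVotes A n k + 1) * (n + τ + 18)
          ≤ 3 * (A + 1) * (2 ^ k * ν) * (19 * (g * ν ^ (a + 1))) :=
            Nat.mul_le_mul (hvotes.trans (by gcongr)) hcall
        _ = _ := by ring
    rw [unitTime]
    omega
  -- The constant is `257 * 64 = 16448`; both logarithmic factors of the work are bounded crudely by
  -- `ν`.
  have hmain : unitTime n (numVotes A n k) τ * (M * (4 * 2 ^ k * (1 + D * N))) ≤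
      16448 * ((A + 1) * 2 ^ (2 * k) * g * ν ^ (a + 4) * max 1 N * L) := by
    calc unitTime n (numVotes A n k) τ * (M * (4 * 2 ^ k * (1 + D * N)))
        ≤ 257 * ((A + 1) * 2 ^ k * g * ν ^ (a + 2)) * (64 * (ν ^ 2 * L * 2 ^ k * max 1 N)) :=
          Nat.mul_le_mul hunit (hwork.trans (by gcongr))
      _ = _ := by ring
  have hrest : 52 * ν * M + 100 * (n + k + D + L + 1) ≤
      1000 * ((A + 1) * 2 ^ (2 * k) * g * ν ^ (a + 4) * max 1 N * L) := by
    have hbase : 1 * 2 ^ k * 1 * ν ^ 2 * 1 * L ≤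
        (A + 1) * 2 ^ (2 * k) * g * ν ^ (a + 4) * max 1 N * L := by
      gcongr
      · omega
      · norm_num
      · omega
      · omega
    have h1 : 52 * ν * M ≤ 416 * (ν ^ 2 * L) := by
      calc 52 * ν * M ≤ 52 * ν * (8 * (ν * L)) := by gcongr
        _ = _ := by ring
    have hp1 : 1 ≤ ν ^ 2 := Nat.one_le_pow _ _ hν1
    have hp2 : ν ≤ ν ^ 2 := Nat.le_self_pow (by norm_num) ν
    have hp3 : 1 ≤ 2 ^ k := Nat.one_le_two_pow
    have hX1 : ν ^ 2 * L ≤ 2 ^ k * ν ^ 2 * L := by nlinarith [Nat.zero_le (ν ^ 2 * L)]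
    have hX2 : ν ^ 2 ≤ ν ^ 2 * L := Nat.le_mul_of_pos_right _ hL1
    have hX3 : L ≤ ν ^ 2 * L := Nat.le_mul_of_pos_left _ hp1
    have hX4 : 2 ^ k ≤ 2 ^ k * (ν ^ 2 * L) :=
      Nat.le_mul_of_pos_right _ (Nat.mul_pos hp1 hL1)
    rw [← mul_assoc] at hX4
    simp only [one_mul, mul_one] at hbase
    omega
  have hnat := Nat.add_le_add hmain hrest
  have hN : (0 : ℝ) ≤ max 1 (N : ℝ) := le_trans zero_le_one (le_max_left _ _)
  have hνR : (1 : ℝ) ≤ (n : ℝ) + 1 := by linarith [n.cast_nonneg (α := ℝ)]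
  calc ((unitTime n (numVotes A n k) τ * (M * (4 * 2 ^ k * (1 + D * N))) +
        (52 * ν * M + 100 * (n + k + D + L + 1)) : ℕ) : ℝ)
      ≤ ((16448 * ((A + 1) * 2 ^ (2 * k) * g * ν ^ (a + 4) * max 1 N * L) +
          1000 * ((A + 1) * 2 ^ (2 * k) * g * ν ^ (a + 4) * max 1 N * L) : ℕ) : ℝ) :=
        Nat.cast_le.2 hnat
    _ = (17448 * (A + 1)) * 2 ^ (2 * k) * g * ((n : ℝ) + 1) ^ (a + 4) * max 1 (N : ℝ) * L := by
        rw [hν]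
        push_cast
        ring
    _ ≤ (17448 * (A + 1)) * 2 ^ (2 * k) * g * ((n : ℝ) + 1) ^ (a + 4) * max 1 (N : ℝ) *
          (2 * E) := by gcongr
    _ = (34896 * (A + 1)) * 2 ^ (2 * k) * g * ((n : ℝ) + 1) ^ (a + 4) * max 1 (N : ℝ) * E := by
        ring
    _ ≤ C * 2 ^ (C * k) * g * ((n : ℝ) + 1) ^ C * max 1 (N : ℝ) * E ^ C := by
        have hCA : (34896 * (A + 1) : ℝ) ≤ C := by
          rw [hC]
          push_cast
          nlinarith [a.cast_nonneg (α := ℝ), A.cast_nonneg (α := ℝ)]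
        gcongr
        · norm_num
        · omega
        · omega
        · exact le_self_pow₀ hE1 (by omega)

end final

end WitnessEnum

theorem mainTheorem2 (c : ℝ) (hc : c < 1 / 2) :
    ∃ P : WitnessEnum.Cmd,
      (∀ (I : WitnessEnum.Instance) (ora : Finset (Fin I.n) → PMF Bool) (τ : ℕ) (ε : ℝ),
        WitnessEnum.IsRandomisedOracle I c ora → 0 < ε →
          WitnessEnum.OutputsOnlyWitnesses P I ora τ ε ∧
          ∀ W ∈ I.witnesses,
            ENNReal.ofReal (1 - ε) ≤ WitnessEnum.probListedOnce P I ora τ ε W) ∧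
      (∃ C : ℕ, ∀ (I : WitnessEnum.Instance) (ora : Finset (Fin I.n) → PMF Bool) (τ : ℕ) (ε : ℝ),
        WitnessEnum.IsRandomisedOracle I c ora → 0 < ε →
          WitnessEnum.expectedCalls P I ora τ ε ≤
            ENNReal.ofReal (C * 2 ^ (C * I.k) * Real.log (I.n + 2) ^ 3 *
              max 1 (I.witnesses.card : ℝ) * (1 + Real.log (1 + 1 / ε)) ^ C)) ∧
      (∀ a : ℕ, ∃ C : ℕ, ∀ g : ℕ → ℕ, (∀ k, 1 ≤ g k) →
        ∀ (I : WitnessEnum.Instance) (ora : Finset (Fin I.n) → PMF Bool) (τ : ℕ) (ε : ℝ),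
          WitnessEnum.IsRandomisedOracle I c ora → 0 < ε → τ ≤ g I.k * I.n ^ a →
            WitnessEnum.expectedTime P I ora τ ε ≤
              ENNReal.ofReal (C * 2 ^ (C * I.k) * g I.k * (I.n + 1) ^ C *
                max 1 (I.witnesses.card : ℝ) * (1 + Real.log (1 + 1 / ε)) ^ C)) := by
  -- The program depends on `c` only through `A`, the number of answers that halves the error of a
  -- vote.
  obtain ⟨A, hA⟩ := WitnessEnum.exists_votes hc
  refine ⟨WitnessEnum.Prog.main A, fun I ora τ ε hora hε =>
    ⟨WitnessEnum.outputsOnlyWitnesses_main A, fun W hW =>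
      WitnessEnum.le_probListedOnce_main (fun X => hA (ora X) _ (hora X)) hε hW⟩,
    ⟨48000 * (A + 1), fun I ora τ ε hora hε => ?_⟩,
    fun a => ⟨40000 * (A + 1) + a + 4, fun g hg I ora τ ε hora hε hτ => ?_⟩⟩
  · refine (WitnessEnum.expectedCalls_main_le A).trans ((mul_le_mul_right
      (WitnessEnum.expect_work_enumeration (fun X => hA (ora X) _ (hora X)) _) _).trans ?_)
    rw [← Nat.cast_mul, ← ENNReal.ofReal_natCast]
    exact ENNReal.ofReal_le_ofReal (WitnessEnum.calls_bound A I.n I.k I.witnesses.card hε)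
  · refine (WitnessEnum.expectedTime_main_le A).trans ((add_le_add_left (mul_le_mul_right
      (WitnessEnum.expect_work_enumeration (fun X => hA (ora X) _ (hora X)) _) _) _).trans ?_)
    rw [← Nat.cast_mul, ← Nat.cast_add, ← ENNReal.ofReal_natCast]
    exact ENNReal.ofReal_le_ofReal
      (WitnessEnum.time_bound A a I.n I.k I.witnesses.card (g I.k) τ (hg _) hτ hε)
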